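/- **Setting.** There are periods $t=1,\dots,\mathcal T$. A unit has potential outcomes $Y_t(0),Y_t(1)$, covariates $X\in\mathbb R^k$ and binary treatment indicators $D_t$; the observed outcome is $Y_t=D_tY_t(1)+(1-D_t)Y_t(0)$. Let $G_g=1$ if the unit is first treated in period $g$ (and $0$ otherwise), $C=1$ if it is never treated (and $0$ otherwise), and $p_g(X)=P(G_g=1\mid X,\,G_g+C=1)$. Write $\mathcal W$ for the observed data $(Y_1,\dots,Y_{\mathcal T},X,D_1,\dots,D_{\mathcal T})$ of a unit. **Assumptions.** 1. The observed data $\mathcal W_1,\mathcal W_2,\dots$ are iid copies of $\mathcal W$. 2. For all $2\le g\le t\le\mathcal T$, $E[Y_t(0)-Y_{t-1}(0)\mid X,G_g=1]=E[Y_t(0)-Y_{t-1}(0)\mid X,C=1]$ a.s. (these expectations exist). 3. For $t=2,\dots,\mathcal T$, $D_{t-1}=1$ implies $D_t=1$ a.s. 4. For all $g=2,\dots,\mathcal T$, $P(G_g=1)>0$ and, for some $\varepsilon>0$, $p_g(X)<1-\varepsilon$ a.s. (given $G_g+C=1$). 5. For every $g=2,\dots,\mathcal T$ there are a known function $\Lambda_g:\mathbb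 R\to[0,1]$, a compact set $\Pi_g\subset\mathbb R^k$ and $\pi_g^0\in\mathrm{int}(\Pi_g)$ with $p_g(X)=\Lambda_g(X'\pi_g^0)$ a.s. given $G_g+C=1$; the support $\mathcal X$ of $X$ is contained in a compact set; $E[XX'\mid G_g+C=1]$ is positive definite; with $\mathcal U_g=\{x'\pi:x\in\mathcal X,\pi\in\Pi_g\}$, there is $\varepsilon>0$ with $\Lambda_g(u)\in[\varepsilon,1-\varepsilon]$ for $u\in\mathcal U_g$, and on $\mathcal U_g$ the function $\Lambda_g$ is strictly increasing and twice continuously differentiable (in a neighbourhood of each point of $\mathcal U_g$), with first derivative bounded and bounded away from zero and bounded second derivative. Moreover $E[Y_t^2]<\infty$ for all $t$. **Influence functions.** Put $\dot p_g(X)=\Lambda_g'(X'\pi_g^0)$, $$w_g^G=\frac{G_g}{E[G_g]},\qquad w_g^C=\frac{p_g(X)C}{1-p_g(X)}\Big/E\Big[\frac{p_g(X)C}{1-p_g(X)}\Big],$$ $$\xi_g^\pi(\mathcal W)=E\Big[\frac{(G_g+C)\dot p_g(X)^2}{p_g(X)(1-p_g(X))}XX'\Big]^{-1}X\,\frac{(G_g+C)(G_g-p_g(X))\dot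 p_g(X)}{p_g(X)(1-p_g(X))},$$ $$M_{gt}=E\Big[X\Big(\frac{C}{1-p_g(X)}\Big)^2\dot p_g(X)\big\{(Y_t-Y_{g-1})-E[w_g^C(Y_t-Y_{g-1})]\big\}\Big]\Big/E\Big[\frac{p_g(X)C}{1-p_g(X)}\Big],$$ and $$\psi_{gt}(\mathcal W)=w_g^G\{(Y_t-Y_{g-1})-E[w_g^G(Y_t-Y_{g-1})]\}-w_g^C\{(Y_t-Y_{g-1})-E[w_g^C(Y_t-Y_{g-1})]\}-M_{gt}'\,\xi_g^\pi(\mathcal W).$$ Let $\Psi_{g\le t}$ be the vector of all $\psi_{gt}$ with $2\le g\le t\le\mathcal T$, and $\Sigma=E[\Psi_{g\le t}(\mathcal W)\Psi_{g\le t}(\mathcal W)']$. **Estimators.** Let $E_n[Z]=n^{-1}\sum_{i=1}^nZ_i$, and let $\hat\pi_g$ be a (measurable) maximum likelihood estimator, i.e. a.s. a maximizer over $\Pi_g$ of $$\sum_{i\le n:\,G_{ig}+C_i=1}G_{ig}\ln\Lambda_g(X_i'\pi)+(1-G_{ig})\ln(1-\Lambda_g(X_i'\pi)).$$ Put $\hat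 p_g(X)=\Lambda_g(X'\hat\pi_g)$. Let $$\widehat{ATT}(g,t)=E_n\Big[\Big(\frac{G_g}{E_n[G_g]}-\frac{\hat p_g(X)C}{1-\hat p_g(X)}\Big/E_n\Big[\frac{\hat p_g(X)C}{1-\hat p_g(X)}\Big]\Big)(Y_t-Y_{g-1})\Big],$$ let $\widehat{ATT}_{g\le t}$ be the vector of these for $2\le g\le t\le\mathcal T$, and let $\widehat\Psi_{g\le t}$ be obtained from $\Psi_{g\le t}$ by replacing all expectations by $E_n$, $p_g$ by $\hat p_g$ and $\dot p_g(X)$ by $\Lambda_g'(X'\hat\pi_g)$. Let $V_1,V_2,\dots$ be iid with mean zero, unit variance and bounded support, independent of the sample, and define the bootstrap draw $$\widehat{ATT}^*_{g\le t}=\widehat{ATT}_{g\le t}+E_n[V\cdot\widehat\Psi_{g\le t}(\mathcal W)].$$ **Theorem.** Under Assumptions 1–5, $\Psi_{g\le t}(\mathcal W)$ is square integrable and, as $n\to\infty$, the conditional law of $\sqrt n\,(\widehat{ATT}^*_{g\le t}-\widehat{ATT}_{g\le t})$ given the sample $\mathcal W_1,\dots,\mathcal W_n$ converges weakly to $N(0,\Sigma)$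 in probability. That is, for every bounded continuous function $f$, $$E\big[f\big(\sqrt n(\widehat{ATT}^*_{g\le t}-\widehat{ATT}_{g\le t})\big)\,\big|\,\mathcal W_1,\dots,\mathcal W_n\big]\to\int f\,dN(0,\Sigma)\quad\text{in probability}.$$ Moreover, for every continuous functional $\Gamma$ (with values in any topological space), the conditional law of $\Gamma(\sqrt n(\widehat{ATT}^*_{g\le t}-\widehat{ATT}_{g\le t}))$ given the sample converges weakly in probability, in the same sense, to the law of $\Gamma(N(0,\Sigma))$. -/

import Mathlib

open MeasureTheory ProbabilityTheory Filter Topology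
open scoped BoundedContinuousFunction Matrix

namespace DID

/-! ### Periods, units, observations -/

/-- The periods `1, …, T`. -/
abbrev Period (T : ℕ) : Type := {t : ℕ // t ∈ Finset.Icc 1 T}

/-- The period `g - 1`; it is only used for `2 ≤ g` (for `g = 1` the value is `1`). -/
def Period.before {T : ℕ} (g : Period T) : Period T :=
  ⟨max (g.1 - 1) 1, by
    have h := Finset.mem_Icc.mp g.2
    exact Finset.mem_Icc.mpr ⟨le_max_right _ _, by omega⟩⟩

/-- Indices `(g, t)` with `2 ≤ g ≤ t ≤ T`. -/
abbrev GroupTime (T : ℕ) : Type := {i : Period T × Period T // 2 ≤ i.1.1 ∧ i.1 ≤ i.2}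

/-- A unit together with its potential outcomes:
`((Y_t(0))_t, (Y_t(1))_t, X, (D_t)_t)`, with `k` covariates. -/
abbrev PotentialUnit (T k : ℕ) : Type :=
  (Period T → ℝ) × (Period T → ℝ) × EuclideanSpace ℝ (Fin k) × (Period T → Bool)

/-- The observed data of a unit: `((Y_t)_t, X, (D_t)_t)`. -/
abbrev Obs (T k : ℕ) : Type :=
  (Period T → ℝ) × EuclideanSpace ℝ (Fin k) × (Period T → Bool)

variable {T k : ℕ}

/-- The observed data, with `Y_t = D_t Y_t(1) + (1 - D_t) Y_t(0)`. -/
def observe (u : PotentialUnit T k) : Obs T k :=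
  (fun t => if u.2.2.2 t then u.2.1 t else u.1 t, u.2.2.1, u.2.2.2)

lemma measurable_observe : Measurable (observe : PotentialUnit T k → Obs T k) := by
  unfold observe
  refine Measurable.prodMk ?_ (Measurable.prodMk (by fun_prop) (by fun_prop))
  refine measurable_pi_lambda _ fun t => Measurable.ite ?_ (by fun_prop) (by fun_prop)
  have h : Measurable fun u : PotentialUnit T k => u.2.2.2 t := by fun_prop
  exact h (MeasurableSet.singleton true)

/-- The outcome `Y_t`. -/
def outcome (t : Period T) (w : Obs T k) : ℝ := w.1 t

/-- The covariates `X`. -/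
def covariate (w : Obs T k) : EuclideanSpace ℝ (Fin k) := w.2.1

/-- The treatment status `D_t`. -/
def treated (t : Period T) (w : Obs T k) : Bool := w.2.2 t

/-- The unit is first treated in period `g`. -/
def FirstTreatedAt (g : Period T) (d : Period T → Bool) : Prop :=
  d g = true ∧ ∀ s, s < g → d s = false

/-- The unit is never treated. -/
def NeverTreated (d : Period T → Bool) : Prop := ∀ s, d s = false

open Classical in
/-- The group indicator `G_g`. -/
noncomputable def grp (g : Period T) (w : Obs T k) : ℝ :=
  if FirstTreatedAt g w.2.2 then 1 else 0

open Classical in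
/-- The control indicator `C`. -/
noncomputable def ctrl (w : Obs T k) : ℝ := if NeverTreated w.2.2 then 1 else 0

/-- The event `G_g + C = 1`. -/
def groupOrControl (g : Period T) : Set (Obs T k) := {w | grp g w + ctrl w = 1}

/-- The long difference `Y_t - Y_{g-1}`. -/
def longDiff (g t : Period T) (w : Obs T k) : ℝ := outcome t w - outcome g.before w

/-- The σ-algebra generated by `X`. -/
abbrev sigmaX : MeasurableSpace (Obs T k) := MeasurableSpace.comap covariate inferInstance

/-- The generalized propensity score `p_g(X) = P(G_g = 1 | X, G_g + C = 1)`. -/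
noncomputable def pscore (μ : Measure (Obs T k)) (g : Period T) : Obs T k → ℝ :=
  (ProbabilityTheory.cond μ (groupOrControl g))[grp g | sigmaX]

/-! ### Assumptions -/

/-- The σ-algebra generated by `X` on units with potential outcomes. -/
abbrev sigmaXPotential : MeasurableSpace (PotentialUnit T k) :=
  MeasurableSpace.comap (fun u => u.2.2.1) inferInstance

/-- Conditional parallel trends: for `2 ≤ g ≤ t ≤ T`, almost surely
`E[Y_t(0) - Y_{t-1}(0) | X, G_g = 1] = E[Y_t(0) - Y_{t-1}(0) | X, C = 1]`, i.e. one function of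
the covariates is a version of both conditional expectations (which exist). -/
def ParallelTrends (Q : Measure (PotentialUnit T k)) : Prop :=
  ∀ g t : Period T, 2 ≤ g.1 → g ≤ t →
    let trend : PotentialUnit T k → ℝ := fun u => u.1 t - u.1 t.before
    let Qg : Measure (PotentialUnit T k) := ProbabilityTheory.cond Q {u | FirstTreatedAt g u.2.2.2}
    let Qc : Measure (PotentialUnit T k) := ProbabilityTheory.cond Q {u | NeverTreated u.2.2.2}
    Integrable trend Qg ∧ Integrable trend Qc ∧
      ∃ m : EuclideanSpace ℝ (Fin k) → ℝ, Measurable m ∧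
        Qg[trend | sigmaXPotential] =ᵐ[Qg] (fun u => m u.2.2.1) ∧
        Qc[trend | sigmaXPotential] =ᵐ[Qc] (fun u => m u.2.2.1)

/-- Irreversibility of treatment: for `t = 2, …, T`, `D_{t-1} = 1` implies `D_t = 1`. -/
def Irreversible (μ : Measure (Obs T k)) : Prop :=
  ∀ t : Period T, 2 ≤ t.1 → ∀ᵐ w ∂μ, treated t.before w = true → treated t w = true

/-- Overlap: for `g = 2, …, T`, `P(G_g = 1) > 0` and `p_g(X) < 1 - ε` almost surely, for some
`ε > 0`. -/
def Overlap (μ : Measure (Obs T k)) : Prop :=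
  ∀ g : Period T, 2 ≤ g.1 → 0 < μ {w | grp g w = 1} ∧
    ∃ ε : ℝ, 0 < ε ∧ ∀ᵐ w ∂(ProbabilityTheory.cond μ (groupOrControl g)), pscore μ g w < 1 - ε

/-- The support of `X`. -/
def suppX (μ : Measure (Obs T k)) : Set (EuclideanSpace ℝ (Fin k)) :=
  (μ.map covariate).support

/-- The set of index values `{x'π : x ∈ supp X, π ∈ Π}`. -/
def indexSet (μ : Measure (Obs T k)) (Par : Set (EuclideanSpace ℝ (Fin k))) : Set ℝ :=
  {u | ∃ x ∈ suppX μ, ∃ π ∈ Par, u = inner ℝ x π}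

/-- The conditions on the parametric model `p_g(X) = Λ(X'π⁰)` with parameter space `Par`
for one group `g`. -/
structure PropensityModel (μ : Measure (Obs T k)) (g : Period T) (Λ : ℝ → ℝ)
    (Par : Set (EuclideanSpace ℝ (Fin k))) (π₀ : EuclideanSpace ℝ (Fin k)) : Prop where
  range_mem : ∀ u, Λ u ∈ Set.Icc (0 : ℝ) 1
  model : pscore μ g =ᵐ[ProbabilityTheory.cond μ (groupOrControl g)] fun w => Λ (inner ℝ (covariate w) π₀)
  par_compact : IsCompact Par
  true_mem : π₀ ∈ interior Par
  support_compact : ∃ S : Set (EuclideanSpace ℝ (Fin k)), IsCompact S ∧ suppX μ ⊆ S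
  secondMoment_posDef : (Matrix.of fun a b : Fin k =>
    ∫ w, covariate w a * covariate w b ∂(ProbabilityTheory.cond μ (groupOrControl g))).PosDef
  away_from_zero_one : ∃ ε : ℝ, 0 < ε ∧ ∀ u ∈ indexSet μ Par, Λ u ∈ Set.Icc ε (1 - ε)
  strictMono : StrictMonoOn Λ (indexSet μ Par)
  smooth : ∀ u ∈ indexSet μ Par, ContDiffAt ℝ 2 Λ u
  deriv_bounds : ∃ c B : ℝ, 0 < c ∧ ∀ u ∈ indexSet μ Par, c ≤ deriv Λ u ∧ deriv Λ u ≤ B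
  deriv2_bound : ∃ B : ℝ, ∀ u ∈ indexSet μ Par, |deriv (deriv Λ) u| ≤ B

/-- `E[Y_t²] < ∞` for all `t`. -/
def SquareIntegrableOutcomes (μ : Measure (Obs T k)) : Prop :=
  ∀ t : Period T, MemLp (outcome t) 2 μ

/-! ### Estimands, estimators, influence functions

In this part `E` is an expectation functional (the population expectation or the sample average),
`p` stands for `p_g(X)` and `dp` for `ṗ_g(X)` (true or estimated). -/

/-- The odds weight `p_g(X) C / (1 - p_g(X))`. -/
noncomputable def oddsWeight (p : Obs T k → ℝ) (w : Obs T k) : ℝ :=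
  p w * ctrl w / (1 - p w)

/-- The normalized weight `w_g^G`. -/
noncomputable def weightG (E : (Obs T k → ℝ) → ℝ) (g : Period T) (w : Obs T k) : ℝ :=
  grp g w / E (grp g)

/-- The normalized weight `w_g^C`. -/
noncomputable def weightC (E : (Obs T k → ℝ) → ℝ) (p : Obs T k → ℝ) (w : Obs T k) : ℝ :=
  oddsWeight p w / E (oddsWeight p)

/-- `E[(w_g^G - w_g^C)(Y_t - Y_{g-1})]`. -/
noncomputable def attFormula (E : (Obs T k → ℝ) → ℝ) (g t : Period T) (p : Obs T k → ℝ) : ℝ :=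
  E fun w => (weightG E g w - weightC E p w) * longDiff g t w

/-- `E[(G_g + C) ṗ_g(X)² / (p_g(X)(1 - p_g(X))) X X']`. -/
noncomputable def infoMatrix (E : (Obs T k → ℝ) → ℝ) (g : Period T) (p dp : Obs T k → ℝ) :
    Matrix (Fin k) (Fin k) ℝ :=
  Matrix.of fun a b => E fun w =>
    (grp g w + ctrl w) * dp w ^ 2 / (p w * (1 - p w)) * (covariate w a * covariate w b)

/-- The influence function `ξ_g^π` of the maximum likelihood estimator. -/
noncomputable def scoreInfluence (E : (Obs T k → ℝ) → ℝ) (g : Period T) (p dp : Obs T k → ℝ)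
    (w : Obs T k) : Fin k → ℝ :=
  (infoMatrix E g p dp)⁻¹ *ᵥ fun a =>
    covariate w a * ((grp g w + ctrl w) * (grp g w - p w) * dp w / (p w * (1 - p w)))

/-- The vector `M_gt`. -/
noncomputable def Mvec (E : (Obs T k → ℝ) → ℝ) (g t : Period T) (p dp : Obs T k → ℝ) :
    Fin k → ℝ := fun a =>
  E (fun w => covariate w a * (ctrl w / (1 - p w)) ^ 2 * dp w *
      (longDiff g t w - E fun v => weightC E p v * longDiff g t v)) / E (oddsWeight p)

/-- `ψ_gt^G`. -/
noncomputable def psiG (E : (Obs T k → ℝ) → ℝ) (g t : Period T) (w : Obs T k) : ℝ :=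
  weightG E g w * (longDiff g t w - E fun v => weightG E g v * longDiff g t v)

/-- `ψ_gt^C`. -/
noncomputable def psiC (E : (Obs T k → ℝ) → ℝ) (g t : Period T) (p dp : Obs T k → ℝ)
    (w : Obs T k) : ℝ :=
  weightC E p w * (longDiff g t w - E fun v => weightC E p v * longDiff g t v)
    + Mvec E g t p dp ⬝ᵥ scoreInfluence E g p dp w

/-- The vector `Ψ_{g ≤ t}` of the `ψ_gt = ψ_gt^G - ψ_gt^C`. -/
noncomputable def PsiVec (E : (Obs T k → ℝ) → ℝ) (p dp : Period T → Obs T k → ℝ)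
    (w : Obs T k) : EuclideanSpace ℝ (GroupTime T) :=
  WithLp.toLp 2 fun i =>
    psiG E i.1.1 i.1.2 w - psiC E i.1.1 i.1.2 (p i.1.1) (dp i.1.1) w

/-- The true `Ψ_{g ≤ t}`, with `p_g(X)` the generalized propensity score and
`ṗ_g(X) = Λ_g'(X'π_g⁰)`. -/
noncomputable def Psi (μ : Measure (Obs T k)) (Λ : Period T → ℝ → ℝ)
    (π₀ : Period T → EuclideanSpace ℝ (Fin k)) : Obs T k → EuclideanSpace ℝ (GroupTime T) :=
  PsiVec (fun f => ∫ w, f w ∂μ) (fun g => pscore μ g)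
    (fun g w => deriv (Λ g) (inner ℝ (covariate w) (π₀ g)))

/-- `Σ = E[Ψ Ψ']`. -/
noncomputable def asymptoticCov (μ : Measure (Obs T k)) (Λ : Period T → ℝ → ℝ)
    (π₀ : Period T → EuclideanSpace ℝ (Fin k)) : Matrix (GroupTime T) (GroupTime T) ℝ :=
  Matrix.of fun i j => ∫ w, Psi μ Λ π₀ w i * Psi μ Λ π₀ w j ∂μ

/-- The sample average `E_n[f(W)]`. -/
noncomputable def sampleMean {n : ℕ} (s : Fin n → Obs T k) (f : Obs T k → ℝ) : ℝ :=
  (n : ℝ)⁻¹ * ∑ i, f (s i)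

/-- The log-likelihood of the propensity score model of group `g`. -/
noncomputable def logLik {n : ℕ} (s : Fin n → Obs T k) (g : Period T) (Λ : ℝ → ℝ)
    (π : EuclideanSpace ℝ (Fin k)) : ℝ :=
  open Classical in
  ∑ i with grp g (s i) + ctrl (s i) = 1,
    (grp g (s i) * Real.log (Λ (inner ℝ (covariate (s i)) π))
      + (1 - grp g (s i)) * Real.log (1 - Λ (inner ℝ (covariate (s i)) π)))

/-- `π` maximizes the log-likelihood over the parameter space `Par`. -/
def IsMLE {n : ℕ} (s : Fin n → Obs T k) (g : Period T) (Λ : ℝ → ℝ)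
    (Par : Set (EuclideanSpace ℝ (Fin k))) (π : EuclideanSpace ℝ (Fin k)) : Prop :=
  π ∈ Par ∧ IsMaxOn (logLik s g Λ) Par π

/-- The fitted propensity score `p̂_g(X) = Λ_g(X'π̂_g)`. -/
noncomputable def fitted (Λ : Period T → ℝ → ℝ) (π : Period T → EuclideanSpace ℝ (Fin k))
    (g : Period T) (w : Obs T k) : ℝ := Λ g (inner ℝ (covariate w) (π g))

/-- The estimated vector of the `ATT(g,t)`, `g ≤ t`, from the sample `s` and the first-step
estimates `π`. -/
noncomputable def attHat {n : ℕ} (s : Fin n → Obs T k) (Λ : Period T → ℝ → ℝ)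
    (π : Period T → EuclideanSpace ℝ (Fin k)) : EuclideanSpace ℝ (GroupTime T) :=
  WithLp.toLp 2 fun i => attFormula (sampleMean s) i.1.1 i.1.2 (fitted Λ π i.1.1)

/-- The sample analogue of `Ψ_{g ≤ t}`. -/
noncomputable def PsiHat {n : ℕ} (s : Fin n → Obs T k) (Λ : Period T → ℝ → ℝ)
    (π : Period T → EuclideanSpace ℝ (Fin k)) : Obs T k → EuclideanSpace ℝ (GroupTime T) :=
  PsiVec (sampleMean s) (fitted Λ π)
    (fun g w => deriv (Λ g) (inner ℝ (covariate w) (π g)))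

/-- A bootstrap draw with multipliers `v`: the estimated vector plus `E_n[V · Ψ̂(W)]`. -/
noncomputable def attStar {n : ℕ} (s : Fin n → Obs T k) (v : Fin n → ℝ) (Λ : Period T → ℝ → ℝ)
    (π : Period T → EuclideanSpace ℝ (Fin k)) : EuclideanSpace ℝ (GroupTime T) :=
  attHat s Λ π + (n : ℝ)⁻¹ • ∑ i, v i • PsiHat s Λ π (s i)

/-- The first `n` terms of a sequence of random elements. -/
def firstN {Ω α : Type*} (W : ℕ → Ω → α) (n : ℕ) (ω : Ω) : Fin n → α := fun i => W i ω

/-! ### Convergence of conditional laws -/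

/-- Weak convergence in `P`-probability to `ν` of the conditional laws of `Z n` given the
σ-algebras `𝓖 n`: for every bounded continuous `f`, `E[f(Z n) | 𝓖 n] → ∫ f dν` in probability. -/
structure TendstoCondLawInProbability {Ω E : Type*} [mΩ : MeasurableSpace Ω] [TopologicalSpace E]
    [MeasurableSpace E] (P : Measure Ω) (𝓖 : ℕ → MeasurableSpace Ω) (Z : ℕ → Ω → E)
    (ν : Measure E) : Prop where
  le : ∀ n, 𝓖 n ≤ mΩ
  aemeasurable : ∀ n, AEMeasurable (Z n) P
  tendsto : ∀ f : E →ᵇ ℝ,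
    TendstoInMeasure P (fun n => P[fun ω => f (Z n ω) | 𝓖 n]) atTop (fun _ => ∫ z, f z ∂ν)

/-- The σ-algebra generated by the sample `W_1, …, W_n`. -/
abbrev sampleSigma {Ω α : Type*} [MeasurableSpace α] (W : ℕ → Ω → α) (n : ℕ) : MeasurableSpace Ω :=
  MeasurableSpace.comap (firstN W n) inferInstance

end DID

namespace DID

variable {T k : ℕ}

/-! ### A multiplier central limit theorem with deterministic weights -/

/-! The centred and rescaled draw equals `∑ V_i n^{-1/2} Ψ̂(W_i)`. Since the multipliers are
independent of the sample, conditioning on the sample freezes the weights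
(`condExp_eq_integral_of_indepFun`), and what is left along each sample path is a central limit
theorem for iid multipliers with deterministic vector weights (`tendsto_integral_multiplier_sum`).
It needs two facts about the path: the empirical second moments of `Ψ̂` converge to `Σ`, and every
single weight is uniformly negligible.

Both facts follow from one almost sure statement: `Ψ̂` converges to `Ψ` uniformly over the support
of `X`, relative to the square integrable envelope `1 + ∑ |Y_t|`. This mode of convergence
(`WeightedUnif`) is stable under sums and products and allows `f n` to be replaced by its limit
inside sample averages. The influence function can therefore be assembled from its ingredients, with
the strong law supplying the population moments (`weightedUnif_psi`). Convergence of second moments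
is then `tendsto_sum_inner_sq`. Negligibility is `eventually_inner_le`, which rests on the fact that
the maximum of `n` envelope values is `o(√n)` when the averages of their squares converge.

The nuisance functions enter only through consistency of the maximum likelihood estimator, with no
rate. Consistency (`PropensityModel.tendsto_mle`) combines a strong law in the Banach space `C(Par,
ℝ)` with identification: the expected likelihood gap is an integrated Bernoulli Kullback–Leibler
divergence, which vanishes only if the indices agree, and positive definiteness of the second moment
matrix then forces the parameters to agree. Because all limits hold along almost every path, the
conditional expectations converge almost surely, hence in probability. The statement for `Γ` follows
by composing test functions with `Γ`.

`Λ g` is controlled only on the set of index values, so measurability is obtained for a truncated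
version of the draw that agrees with it almost surely. -/

lemma norm_prod_sub_prod_le {ι : Type*} (s : Finset ι) (a b : ι → ℂ)
    (ha : ∀ i ∈ s, ‖a i‖ ≤ 1) (hb : ∀ i ∈ s, ‖b i‖ ≤ 1) :
    ‖∏ i ∈ s, a i - ∏ i ∈ s, b i‖ ≤ ∑ i ∈ s, ‖a i - b i‖ := by
  classical
  induction s using Finset.induction_on with
  | empty => simp
  | insert j s hj ih =>
    rw [Finset.prod_insert hj, Finset.prod_insert hj, Finset.sum_insert hj]
    have h1 := ih (fun i hi => ha i (Finset.mem_insert_of_mem hi))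
      (fun i hi => hb i (Finset.mem_insert_of_mem hi))
    have h2 : ‖∏ i ∈ s, a i‖ ≤ 1 := by
      rw [norm_prod]
      exact Finset.prod_le_one (fun i _ => norm_nonneg _)
        fun i hi => ha i (Finset.mem_insert_of_mem hi)
    have h3 := hb j (Finset.mem_insert_self _ _)
    -- Telescoping: one factor is exchanged at a time.
    have e : a j * ∏ i ∈ s, a i - b j * ∏ i ∈ s, b i
        = (a j - b j) * ∏ i ∈ s, a i + b j * (∏ i ∈ s, a i - ∏ i ∈ s, b i) := by ring
    rw [e]
    refine (norm_add_le _ _).trans (add_le_add ?_ ?_)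
    · rw [norm_mul]
      exact mul_le_of_le_one_right (norm_nonneg _) h2
    · rw [norm_mul]
      exact (mul_le_of_le_one_left (norm_nonneg _) h3).trans h1

/-- A variable with mean zero and unit variance and the standard Gaussian have the same second order
Taylor polynomial at 0; subtracting the two expansions leaves `o(t²)`. -/
lemma charFun_sub_exp_isLittleO {Ω : Type*} [MeasurableSpace Ω] {P : Measure Ω}
    [IsProbabilityMeasure P] {X : Ω → ℝ} (hX : AEMeasurable X P) (h0 : P[X] = 0)
    (h1 : P[X ^ 2] = 1) :
    (fun t : ℝ => charFun (P.map X) t - Complex.exp (-(t ^ 2 / 2))) =o[𝓝 0] fun t => t ^ 2 := by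
  have hid : AEMeasurable (id : ℝ → ℝ) (gaussianReal 0 1) := aemeasurable_id
  have g0 : (gaussianReal 0 1)[(id : ℝ → ℝ)] = 0 := by simp
  have g1 : (gaussianReal 0 1)[(id : ℝ → ℝ) ^ 2] = 1 := by
    have := variance_id_gaussianReal (μ := 0) (v := 1)
    rw [variance_of_integral_eq_zero hid g0] at this
    simpa using this
  have hG := taylor_charFun_two hid g0 g1
  have h := (taylor_charFun_two hX h0 h1).sub hG
  refine h.congr_left fun t => ?_
  rw [Measure.map_id, charFun_gaussianReal]
  have : ((t : ℂ) * ((0 : ℝ) : ℂ) * Complex.I - ((1 : NNReal) : ℂ) * (t : ℂ) ^ 2 / 2)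
      = -((t : ℂ) ^ 2 / 2) := by push_cast; ring
  rw [show Complex.exp ((t : ℂ) * ((0 : ℝ) : ℂ) * Complex.I - ((1 : NNReal) : ℂ) * (t : ℂ) ^ 2 / 2)
    = Complex.exp (-((t : ℂ) ^ 2 / 2)) by rw [this]]
  ring

lemma tendsto_prod_charFun {Ω : Type*} [MeasurableSpace Ω] {P : Measure Ω}
    [IsProbabilityMeasure P] {X : Ω → ℝ} (hX : AEMeasurable X P) (h0 : P[X] = 0)
    (h1 : P[X ^ 2] = 1) (u : (n : ℕ) → Fin n → ℝ) {v : ℝ}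
    (hsum : Tendsto (fun n => ∑ i, u n i ^ 2) atTop (𝓝 v))
    (hmax : ∀ δ > 0, ∀ᶠ n in atTop, ∀ i, |u n i| ≤ δ) :
    Tendsto (fun n => ∏ i, charFun (P.map X) (u n i)) atTop (𝓝 (Complex.exp (-(v / 2)))) := by
  have hexp : Tendsto (fun n => ∏ i, Complex.exp (-((u n i : ℂ) ^ 2 / 2))) atTop
      (𝓝 (Complex.exp (-(v / 2)))) := by
    have e : ∀ n, ∏ i, Complex.exp (-((u n i : ℂ) ^ 2 / 2))
        = Complex.exp (-(((∑ i, u n i ^ 2 : ℝ) : ℂ) / 2)) := by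
      intro n
      rw [← Complex.exp_sum]
      push_cast
      rw [Finset.sum_neg_distrib, Finset.sum_div]
    simp_rw [e]
    refine (Complex.continuous_exp.tendsto _).comp ?_
    exact (((Complex.continuous_ofReal.tendsto v).comp hsum).div_const 2).neg
  have hdiff : Tendsto (fun n => ∏ i, charFun (P.map X) (u n i)
      - ∏ i, Complex.exp (-((u n i : ℂ) ^ 2 / 2))) atTop (𝓝 0) := by
    rw [tendsto_zero_iff_norm_tendsto_zero]
    refine tendsto_order.2 ⟨fun a ha => Eventually.of_forall fun n => ha.trans_le (norm_nonneg _),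
      fun η hη => ?_⟩
    have hv : 0 ≤ v := ge_of_tendsto' hsum fun n => Finset.sum_nonneg fun i _ => sq_nonneg _
    -- The total error is at most this constant times `∑ u²`, which is eventually below `v + 1`. The
    -- denominator `v + 2` is positive even for `v = 0` and leaves room for a strict inequality.
    have hc : 0 < η / (v + 2) := by positivity
    have ho := (charFun_sub_exp_isLittleO hX h0 h1).def hc
    obtain ⟨δ, hδ, hball⟩ := Metric.eventually_nhds_iff.1 ho
    filter_upwards [hmax (δ / 2) (by positivity),
      hsum.eventually (gt_mem_nhds (show v < v + 1 by linarith))] with n hn hs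
    have hP : IsProbabilityMeasure (P.map X) := Measure.isProbabilityMeasure_map hX
    refine (norm_prod_sub_prod_le _ _ _ (fun i _ => norm_charFun_le_one _) (fun i _ => ?_)).trans_lt ?_
    · rw [Complex.norm_exp]
      have : (-((u n i : ℂ) ^ 2 / 2)).re = -(u n i ^ 2 / 2) := by
        norm_cast
      rw [this, Real.exp_le_one_iff]
      nlinarith [sq_nonneg (u n i)]
    · calc ∑ i, ‖charFun (P.map X) (u n i) - Complex.exp (-((u n i : ℂ) ^ 2 / 2))‖
          ≤ ∑ i, η / (v + 2) * u n i ^ 2 := by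
            refine Finset.sum_le_sum fun i _ => ?_
            have := hball (y := u n i) (by
              rw [Real.dist_eq, sub_zero]; linarith [hn i])
            rwa [Real.norm_of_nonneg (sq_nonneg _)] at this
        _ = η / (v + 2) * ∑ i, u n i ^ 2 := by rw [Finset.mul_sum]
        _ ≤ η / (v + 2) * (v + 1) := by gcongr
        _ < η := by
            rw [div_mul_eq_mul_div, div_lt_iff₀ (by linarith)]
            nlinarith
  simpa using hdiff.add hexp

lemma charFun_map_sum_smul {Ω ι : Type*} [MeasurableSpace Ω] [Fintype ι] {P : Measure Ω}
    [IsProbabilityMeasure P] {V : ℕ → Ω → ℝ} (hVm : ∀ i, Measurable (V i)) (hVind : iIndepFun V P)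
    (hVid : ∀ i, IdentDistrib (V i) (V 0) P P) {n : ℕ} (x : Fin n → EuclideanSpace ℝ ι)
    (t : EuclideanSpace ℝ ι) :
    charFun (P.map fun ω => ∑ i : Fin n, V i ω • x i) t
      = ∏ i, charFun (P.map (V 0)) (inner ℝ (x i) t) := by
  have hm : ∀ i : Fin n, Measurable fun ω => V i ω • x i := fun i => (hVm i).smul_const _
  have hind : iIndepFun (fun (i : Fin n) ω => V i ω • x i) P :=
    (hVind.precomp Fin.val_injective).comp (fun i r => r • x i) fun i =>
      measurable_id.smul_const _
  rw [hind.charFun_map_fun_sum_eq_prod fun i => (hm i).aemeasurable, Finset.prod_apply]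
  refine Finset.prod_congr rfl fun i _ => ?_
  rw [← (hVid i).map_eq, charFun_apply, charFun_apply,
    integral_map (hm i).aemeasurable (by fun_prop), integral_map (hVm i).aemeasurable (by fun_prop)]
  refine integral_congr_ae (Eventually.of_forall fun ω => ?_)
  simp only [inner_smul_left, RCLike.inner_apply]
  congr 2
  simp [mul_comm]

/-- The law of `∑ V_i x_{n,i}` converges weakly to a Gaussian law if the covariances converge
and the weights are uniformly negligible. -/
lemma tendsto_integral_multiplier_sum {Ω ι : Type*} [MeasurableSpace Ω] [Fintype ι] [DecidableEq ι]
    {P : Measure Ω} [IsProbabilityMeasure P] {V : ℕ → Ω → ℝ} (hVm : ∀ i, Measurable (V i))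
    (hVind : iIndepFun V P) (hVid : ∀ i, IdentDistrib (V i) (V 0) P P)
    (h0 : P[V 0] = 0) (h1 : P[V 0 ^ 2] = 1) (x : (n : ℕ) → Fin n → EuclideanSpace ℝ ι)
    {S : Matrix ι ι ℝ} (hS : S.PosSemidef)
    (hsum : ∀ t : EuclideanSpace ℝ ι,
      Tendsto (fun n => ∑ i, (inner ℝ (x n i) t) ^ 2) atTop (𝓝 (t ⬝ᵥ S *ᵥ t)))
    (hmax : ∀ t : EuclideanSpace ℝ ι, ∀ δ > 0, ∀ᶠ n in atTop, ∀ i, |inner ℝ (x n i) t| ≤ δ)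
    (f : EuclideanSpace ℝ ι →ᵇ ℝ) :
    Tendsto (fun n => ∫ ω, f (∑ i : Fin n, V i ω • x n i) ∂P) atTop
      (𝓝 (∫ z, f z ∂(multivariateGaussian 0 S))) := by
  have hm : ∀ n, Measurable fun ω => ∑ i : Fin n, V i ω • x n i := fun n =>
    Finset.measurable_fun_sum _ fun i _ => (hVm i).smul_const _
  have hPr : ∀ n, IsProbabilityMeasure (P.map fun ω => ∑ i : Fin n, V i ω • x n i) := fun n =>
    Measure.isProbabilityMeasure_map (hm n).aemeasurable
  let ν : ℕ → ProbabilityMeasure (EuclideanSpace ℝ ι) := fun n => ⟨_, hPr n⟩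
  let ν₀ : ProbabilityMeasure (EuclideanSpace ℝ ι) :=
    ⟨multivariateGaussian 0 S, inferInstance⟩
  have hν : Tendsto ν atTop (𝓝 ν₀) := by
    -- Lévy's continuity theorem: for each direction `t` the claim becomes scalar, with coefficients
    -- `⟨x_{n,i}, t⟩`.
    refine ProbabilityMeasure.tendsto_of_tendsto_charFun fun t => ?_
    have hr : charFun (ν₀ : Measure (EuclideanSpace ℝ ι)) t
        = Complex.exp (-((t ⬝ᵥ S *ᵥ t : ℝ) / 2)) := by
      change charFun (multivariateGaussian 0 S) t = _
      rw [charFun_multivariateGaussian hS]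
      simp
    have hl : ∀ n, charFun (ν n : Measure (EuclideanSpace ℝ ι)) t
        = ∏ i, charFun (P.map (V 0)) (inner ℝ (x n i) t) := fun n =>
      charFun_map_sum_smul hVm hVind hVid (x n) t
    simp_rw [hl, hr]
    exact tendsto_prod_charFun (hVm 0).aemeasurable h0 h1 _ (hsum t) (hmax t)
  have := (ProbabilityMeasure.tendsto_iff_forall_integral_tendsto.1 hν) f
  refine this.congr fun n => ?_
  change ∫ z, f z ∂(P.map fun ω => ∑ i : Fin n, V i ω • x n i) = _
  rw [integral_map (hm n).aemeasurable f.continuous.aestronglyMeasurable]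

/-! ### Conditional expectations given one of two independent components -/

/-- Independence makes the regular conditional distribution of `B` given `A` the constant kernel,
because the joint law is a product. Integrating against that kernel amounts to freezing `A`. -/
lemma condExp_eq_integral_of_indepFun {Ω α β : Type*} [MeasurableSpace Ω] [mα : MeasurableSpace α]
    [MeasurableSpace β] [StandardBorelSpace β] [Nonempty β] {P : Measure Ω}
    [IsProbabilityMeasure P] {A : Ω → α} {B : Ω → β} (hA : Measurable A) (hB : Measurable B)
    (hind : IndepFun A B P) {f : α × β → ℝ} (hf : Measurable f) {c : ℝ} (hc : ∀ z, |f z| ≤ c) :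
    P[fun ω => f (A ω, B ω) | mα.comap A] =ᵐ[P] fun ω => ∫ ω', f (A ω, B ω') ∂P := by
  have hint : Integrable (fun ω => f (A ω, B ω)) P :=
    Integrable.of_bound (hf.comp (hA.prodMk hB)).aestronglyMeasurable c
      (Eventually.of_forall fun ω => hc _)
  have h1 := condExp_prod_ae_eq_integral_condDistrib hA hB.aemeasurable hf.stronglyMeasurable hint
  have h2 : condDistrib B A P =ᵐ[P.map A] Kernel.const α (P.map B) := by
    have := Measure.isProbabilityMeasure_map (μ := P) hB.aemeasurable
    refine condDistrib_ae_eq_of_measure_eq_compProd A hB.aemeasurable ?_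
    rw [Measure.compProd_const]
    exact (indepFun_iff_map_prod_eq_prod_map_map hA.aemeasurable hB.aemeasurable).1 hind
  have h3 := ae_of_ae_map hA.aemeasurable h2
  filter_upwards [h1, h3] with ω e1 e3
  rw [e1, e3, Kernel.const_apply]
  exact integral_map hB.aemeasurable (hf.comp measurable_prodMk_left).aestronglyMeasurable


/-! ### Group and control indicators -/

lemma measurable_outcome (t : Period T) : Measurable (outcome t : Obs T k → ℝ) := by
  unfold outcome; fun_prop

lemma measurable_covariate : Measurable (covariate : Obs T k → EuclideanSpace ℝ (Fin k)) := by
  unfold covariate; fun_prop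

lemma measurable_grp (g : Period T) : Measurable (grp g : Obs T k → ℝ) := by
  classical
  have h : Measurable fun d : Period T → Bool => if FirstTreatedAt g d then (1 : ℝ) else 0 :=
    measurable_of_countable _
  have h2 : Measurable fun w : Obs T k => w.2.2 := by fun_prop
  exact h.comp h2

lemma measurable_ctrl : Measurable (ctrl : Obs T k → ℝ) := by
  classical
  have h : Measurable fun d : Period T → Bool => if NeverTreated d then (1 : ℝ) else 0 :=
    measurable_of_countable _
  have h2 : Measurable fun w : Obs T k => w.2.2 := by fun_prop
  exact h.comp h2

lemma measurable_longDiff (g t : Period T) : Measurable (longDiff g t : Obs T k → ℝ) :=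
  (measurable_outcome t).sub (measurable_outcome _)

/-- A unit belongs to the group, to the controls, or to neither. -/
lemma grp_ctrl_cases (g : Period T) (w : Obs T k) :
    (grp g w = 1 ∧ ctrl w = 0) ∨ (grp g w = 0 ∧ ctrl w = 1) ∨ (grp g w = 0 ∧ ctrl w = 0) := by
  unfold grp ctrl
  by_cases h1 : FirstTreatedAt g w.2.2 <;> by_cases h2 : NeverTreated w.2.2
  · exact absurd (h2 g) (by simp [h1.1])
  all_goals simp [h1, h2]

lemma abs_grp_le (g : Period T) (w : Obs T k) : |grp g w| ≤ 1 := by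
  rcases grp_ctrl_cases g w with h | h | h <;> simp [h]

lemma abs_ctrl_le (w : Obs T k) : |ctrl w| ≤ 1 := by
  unfold ctrl; split_ifs <;> simp

lemma ctrl_eq_zero_or_one (w : Obs T k) : ctrl w = 0 ∨ ctrl w = 1 := by
  unfold ctrl; split_ifs <;> simp

lemma grp_add_ctrl_eq_indicator (g : Period T) (w : Obs T k) :
    grp g w + ctrl w = (groupOrControl g).indicator 1 w := by
  unfold groupOrControl Set.indicator
  rcases grp_ctrl_cases g w with h | h | h <;> simp [h]

lemma measurableSet_groupOrControl (g : Period T) :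
    MeasurableSet (groupOrControl g : Set (Obs T k)) :=
  ((measurable_grp g).add measurable_ctrl) (measurableSet_singleton 1)

variable {μ : Measure (Obs T k)}

lemma measure_groupOrControl_pos {g : Period T} (h : 0 < μ {w | grp g w = 1}) :
    μ (groupOrControl g) ≠ 0 := by
  refine (h.trans_le (measure_mono fun w hw => ?_)).ne'
  rcases grp_ctrl_cases g w with h | h | h <;> simp_all [groupOrControl]

/-- Conditioning rescales the restriction by `(μ s)⁻¹`, which is nonzero as soon as `μ s` is finite.
A null set `s` does no harm: both sides are then trivially true. -/
lemma ae_cond_iff {s : Set (Obs T k)} (hs : MeasurableSet s) (h1 : μ s ≠ ⊤)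
    {p : Obs T k → Prop} :
    (∀ᵐ w ∂(ProbabilityTheory.cond μ s), p w) ↔ ∀ᵐ w ∂μ, w ∈ s → p w := by
  rw [ProbabilityTheory.cond, Measure.ae_ennreal_smul_measure_iff (by simpa using h1),
    ae_restrict_iff' hs]

lemma integral_indicator_mul_eq [IsProbabilityMeasure μ] {s : Set (Obs T k)} (hs : MeasurableSet s) (h0 : μ s ≠ 0)
    (f : Obs T k → ℝ) :
    ∫ w, s.indicator 1 w * f w ∂μ = (μ s).toReal * ∫ w, f w ∂(ProbabilityTheory.cond μ s) := by
  rw [ProbabilityTheory.cond, integral_smul_measure, ENNReal.toReal_inv, smul_eq_mul,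
    ← mul_assoc, mul_inv_cancel₀ (ENNReal.toReal_ne_zero.2 ⟨h0, measure_ne_top _ _⟩), one_mul,
    ← integral_indicator hs]
  refine integral_congr_ae (Eventually.of_forall fun w => ?_)
  by_cases hw : w ∈ s <;> simp [hw]

/-- `E[G h(X)] = E[(G + C) p(X) h(X)]`. -/
lemma integral_grp_mul [IsProbabilityMeasure μ] {g : Period T} (hg : 0 < μ {w | grp g w = 1})
    {h : EuclideanSpace ℝ (Fin k) → ℝ} (hm : Measurable h) {c : ℝ} (hc : ∀ x, |h x| ≤ c) :
    ∫ w, grp g w * h (covariate w) ∂μ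
      = ∫ w, (grp g w + ctrl w) * (pscore μ g w * h (covariate w)) ∂μ := by
  have h0 := measure_groupOrControl_pos hg
  have hs := measurableSet_groupOrControl (k := k) g
  have hP : IsProbabilityMeasure (ProbabilityTheory.cond μ (groupOrControl g)) :=
    cond_isProbabilityMeasure h0
  have e1 : ∀ w : Obs T k, grp g w * h (covariate w)
      = (groupOrControl g).indicator 1 w * (grp g w * h (covariate w)) := by
    intro w
    rw [← grp_add_ctrl_eq_indicator]
    rcases grp_ctrl_cases g w with h | h | h <;> simp [h]
  simp_rw [grp_add_ctrl_eq_indicator]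
  rw [integral_congr_ae (Eventually.of_forall e1), integral_indicator_mul_eq hs h0,
    integral_indicator_mul_eq hs h0]
  congr 1
  have hle : (sigmaX : MeasurableSpace (Obs T k)) ≤ Prod.instMeasurableSpace :=
    measurable_covariate.comap_le
  have hG : Integrable (grp g) (ProbabilityTheory.cond μ (groupOrControl g)) :=
    Integrable.of_bound (measurable_grp g).aestronglyMeasurable 1
      (Eventually.of_forall fun w => abs_grp_le g w)
  have hh : StronglyMeasurable[sigmaX] fun w : Obs T k => h (covariate w) :=
    (hm.comp (comap_measurable covariate)).stronglyMeasurable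
  have hGh : Integrable (grp g * fun w => h (covariate w))
      (ProbabilityTheory.cond μ (groupOrControl g)) := by
    refine Integrable.of_bound ((measurable_grp g).mul
      (hm.comp measurable_covariate)).aestronglyMeasurable (1 * c)
      (Eventually.of_forall fun w => ?_)
    rw [Pi.mul_apply, norm_mul]
    exact mul_le_mul (abs_grp_le g w) (hc _) (norm_nonneg _) zero_le_one
  -- Under the law given `G_g + C = 1`, the factor `h(X)` is known given `X` and can be pulled out
  -- of the conditional expectation of `G_g`, which by definition is the propensity score.
  have hpull := condExp_mul_of_stronglyMeasurable_right hh hGh hG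
  calc ∫ w, grp g w * h (covariate w) ∂(ProbabilityTheory.cond μ (groupOrControl g))
      = ∫ w, ((ProbabilityTheory.cond μ (groupOrControl g))[grp g * fun w => h (covariate w) |
          sigmaX]) w ∂(ProbabilityTheory.cond μ (groupOrControl g)) := by
        rw [integral_condExp hle]; rfl
    _ = _ := integral_congr_ae hpull

lemma covariate_mem_suppX : ∀ᵐ w ∂μ, covariate w ∈ suppX μ :=
  ae_of_ae_map measurable_covariate.aemeasurable Measure.support_mem_ae

lemma dotProduct_mulVec_integral {α ι : Type*} [MeasurableSpace α] [Fintype ι] {ν : Measure α}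
    {F : α → ι → ι → ℝ} (hF : ∀ a b, Integrable (fun w => F w a b) ν) (v : ι → ℝ) :
    v ⬝ᵥ (Matrix.of fun a b => ∫ w, F w a b ∂ν) *ᵥ v
      = ∫ w, ∑ a, ∑ b, v a * v b * F w a b ∂ν := by
  rw [integral_finsetSum]
  · simp only [dotProduct, Matrix.mulVec, Matrix.of_apply, Finset.mul_sum]
    refine Finset.sum_congr rfl fun a _ => ?_
    rw [integral_finsetSum]
    · refine Finset.sum_congr rfl fun b _ => ?_
      rw [integral_const_mul]
      ring
    · exact fun b _ => (hF a b).const_mul _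
  · exact fun a _ => integrable_finsetSum _ fun b _ => (hF a b).const_mul _

/-! ### Laws of large numbers along the sample -/

section Sample

variable {Ω : Type*} [MeasurableSpace Ω] {P : Measure Ω}
  {W : ℕ → Ω → Obs T k}

/-- The strong law is applied to a measurable version of `f`. Almost surely it agrees with `f` at
all sample points at once, since there are countably many of them, each with law `μ`. -/
lemma tendsto_sampleMean (hWm : ∀ i, Measurable (W i)) (hWind : iIndepFun W P)
    (hWlaw : ∀ i, P.map (W i) = μ) {f : Obs T k → ℝ} (hfi : Integrable f μ) :
    ∀ᵐ ω ∂P, Tendsto (fun n => sampleMean (firstN W n ω) f) atTop (𝓝 (∫ w, f w ∂μ)) := by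
  have hid : ∀ i, IdentDistrib (W i) (W 0) P P := fun i =>
    ⟨(hWm i).aemeasurable, (hWm 0).aemeasurable, by rw [hWlaw, hWlaw]⟩
  have hfae : AEMeasurable f μ := hfi.aemeasurable
  set f' := hfae.mk f with hf'
  have hfm : Measurable f' := hfae.measurable_mk
  have hae : ∀ᵐ ω ∂P, ∀ i, f (W i ω) = f' (W i ω) := by
    rw [ae_all_iff]
    intro i
    exact ae_of_ae_map (hWm i).aemeasurable (by rw [hWlaw i]; exact hfae.ae_eq_mk)
  have hint : Integrable (fun ω => f' (W 0 ω)) P := by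
    have : Integrable f' (P.map (W 0)) := by
      rw [hWlaw 0]; exact hfi.congr hfae.ae_eq_mk
    exact this.comp_measurable (hWm 0)
  have h := strong_law_ae (fun i ω => f' (W i ω)) hint
    (fun i j hij => (hWind.indepFun hij).comp hfm hfm) (fun i => (hid i).comp hfm)
  have e : ∫ ω, f' (W 0 ω) ∂P = ∫ w, f w ∂μ := by
    rw [integral_congr_ae hfae.ae_eq_mk, ← integral_map (hWm 0).aemeasurable
      hfm.aestronglyMeasurable, hWlaw 0]
  rw [e] at h
  filter_upwards [h, hae] with ω hω hω'
  refine hω.congr fun n => ?_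
  rw [smul_eq_mul, sampleMean, Finset.sum_range]
  simp [firstN, hω']

/-- Uniform strong law for `a(W) φ(X, π)`, with `π` in a compact set. -/
lemma uniform_sampleMean [IsProbabilityMeasure μ] (hWm : ∀ i, Measurable (W i)) (hWind : iIndepFun W P)
    (hWlaw : ∀ i, P.map (W i) = μ) (hS : IsCompact (suppX μ))
    {K : Set (EuclideanSpace ℝ (Fin k))} [CompactSpace K]
    {a : Obs T k → ℝ} (ham : Measurable a) {c : ℝ} (hac : ∀ w, |a w| ≤ c)
    {φ : EuclideanSpace ℝ (Fin k) → EuclideanSpace ℝ (Fin k) → ℝ}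
    (hφ : ContinuousOn (Function.uncurry φ) (suppX μ ×ˢ K)) :
    ∃ F : C(K, ℝ), (∀ π : K, F π = ∫ w, a w * φ (covariate w) π ∂μ) ∧
      ∀ᵐ ω ∂P, ∃ Fn : ℕ → C(K, ℝ),
        (∀ n (π : K), Fn n π = sampleMean (firstN W n ω) fun w => a w * φ (covariate w) π) ∧
        Tendsto Fn atTop (𝓝 F) := by
  classical
  -- Uniformity in `π` comes from viewing `π ↦ a(W) φ(X, π)` as a random element of the Banach space
  -- `C(K, ℝ)` and using the strong law there. Currying makes it continuous in `x` on the closed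
  -- support; it is set to 0 elsewhere.
  let _ : MeasurableSpace C(K, ℝ) := borel _
  have : BorelSpace C(K, ℝ) := ⟨rfl⟩
  have : CompactSpace (suppX μ) := isCompact_iff_compactSpace.1 hS
  have hcl : IsClosed (suppX μ) := Measure.isClosed_support
  let Φ₀ : C(suppX μ × K, ℝ) := ⟨fun z => φ z.1 z.2, by
    refine hφ.comp_continuous (f := fun z : suppX μ × K => ((z.1 : EuclideanSpace ℝ (Fin k)),
      (z.2 : EuclideanSpace ℝ (Fin k)))) (by fun_prop) fun z => ⟨z.1.2, z.2.2⟩⟩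
  let Φ : EuclideanSpace ℝ (Fin k) → C(K, ℝ) := fun x =>
    if h : x ∈ suppX μ then Φ₀.curry ⟨x, h⟩ else 0
  have hΦm : Measurable Φ :=
    Measurable.dite (s := suppX μ) (Φ₀.curry.continuous.measurable) measurable_const
      hcl.measurableSet
  have hΦb : ∀ x, ‖Φ x‖ ≤ ‖Φ₀‖ := by
    intro x
    rw [ContinuousMap.norm_le _ (norm_nonneg _)]
    intro π
    by_cases h : x ∈ suppX μ
    · simp only [Φ, dif_pos h]
      exact Φ₀.norm_coe_le_norm (⟨x, h⟩, π)
    · simp [Φ, dif_neg h]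
  have hΦe : ∀ x ∈ suppX μ, ∀ π : K, Φ x π = φ x π := by
    intro x h π
    simp only [Φ, dif_pos h]
    rfl
  let X : Obs T k → C(K, ℝ) := fun w => a w • Φ (covariate w)
  have hXm : Measurable X := ham.smul (hΦm.comp measurable_covariate)
  have hXi : Integrable X μ := by
    refine Integrable.of_bound hXm.aestronglyMeasurable (c * ‖Φ₀‖)
      (Eventually.of_forall fun w => ?_)
    rw [norm_smul]
    exact mul_le_mul (hac w) (hΦb _) (norm_nonneg _) ((abs_nonneg _).trans (hac w))
  have hXi0 : Integrable (fun ω => X (W 0 ω)) P := by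
    have : Integrable X (P.map (W 0)) := by rwa [hWlaw 0]
    exact this.comp_measurable (hWm 0)
  have h := strong_law_ae (fun i ω => X (W i ω)) hXi0
    (fun i j hij => (hWind.indepFun hij).comp hXm hXm)
    (fun i => IdentDistrib.comp (⟨(hWm i).aemeasurable, (hWm 0).aemeasurable, by
      rw [hWlaw, hWlaw]⟩ : IdentDistrib (W i) (W 0) P P) hXm)
  have e : ∫ ω, X (W 0 ω) ∂P = ∫ w, X w ∂μ := by
    rw [← hWlaw 0, integral_map (hWm 0).aemeasurable hXm.aestronglyMeasurable]
  rw [e] at h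
  refine ⟨∫ w, X w ∂μ, fun π => ?_, ?_⟩
  · have := (ContinuousMap.evalCLM ℝ π).integral_comp_comm hXi
    refine Eq.trans this.symm (integral_congr_ae ?_)
    filter_upwards [covariate_mem_suppX (μ := μ)] with w hw
    change a w * Φ (covariate w) π = _
    rw [hΦe _ hw]
  · have hcov : ∀ᵐ ω ∂P, ∀ i, covariate (W i ω) ∈ suppX μ := by
      rw [ae_all_iff]
      intro i
      exact ae_of_ae_map (hWm i).aemeasurable (by rw [hWlaw i]; exact covariate_mem_suppX)
    filter_upwards [h, hcov] with ω hω hc'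
    refine ⟨_, fun n π => ?_, hω⟩
    rw [ContinuousMap.smul_apply, ContinuousMap.sum_apply, smul_eq_mul, sampleMean,
      Finset.sum_range]
    congr 1
    refine Finset.sum_congr rfl fun i _ => ?_
    change a (W i ω) * Φ (covariate (W i ω)) π = _
    rw [hΦe _ (hc' i)]
    rfl

end Sample

/-- Maximizers of uniformly converging functions on a compact space converge to the unique
maximizer of the limit. -/
lemma tendsto_of_isMax {K : Type*} [TopologicalSpace K] [CompactSpace K] {Fn : ℕ → C(K, ℝ)}
    {F : C(K, ℝ)} (hF : Tendsto Fn atTop (𝓝 F)) {x₀ : K} (hx₀ : ∀ x, x ≠ x₀ → F x < F x₀)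
    {x : ℕ → K} (hx : ∀ n, Fn n x₀ ≤ Fn n (x n)) : Tendsto x atTop (𝓝 x₀) := by
  rw [tendsto_nhds]
  intro U hU hxU
  obtain hem | hne := (Uᶜ).eq_empty_or_nonempty
  · have : U = Set.univ := by simpa using hem
    simp [this]
  -- On the compact complement of a neighbourhood of `x₀` the limit stays below `F x₀` by a fixed
  -- gap. Once `Fn n` is within half the gap, its value at `x₀` beats all values on the complement.
  obtain ⟨y, hy, hmax⟩ := hU.isClosed_compl.isCompact.exists_isMaxOn hne F.continuous.continuousOn
  have hlt : F y < F x₀ := hx₀ y fun h => hy (h ▸ hxU)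
  have hdist := (Metric.tendsto_nhds.1 hF) ((F x₀ - F y) / 2) (by linarith)
  filter_upwards [hdist] with n hn
  by_contra hxn
  have h1 := hmax (show x n ∈ Uᶜ from hxn)
  have h2 := (ContinuousMap.dist_apply_le_dist (f := Fn n) (g := F) (x n)).trans_lt hn
  have h3 := (ContinuousMap.dist_apply_le_dist (f := Fn n) (g := F) x₀).trans_lt hn
  rw [Real.dist_eq, abs_lt] at h2 h3
  have h4 := hx n
  simp only [Set.mem_ofPred_eq] at h1
  linarith [h2.1, h2.2, h3.1, h3.2]


/-! ### Consequences of the propensity score model -/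

section Model

variable {μ : Measure (Obs T k)} {g : Period T} {Λ : ℝ → ℝ}
  {Par : Set (EuclideanSpace ℝ (Fin k))} {π₀ : EuclideanSpace ℝ (Fin k)}

lemma PropensityModel.isCompact_suppX (hm : PropensityModel μ g Λ Par π₀) :
    IsCompact (suppX μ) := by
  obtain ⟨S, hS, hsub⟩ := hm.support_compact
  exact hS.of_isClosed_subset Measure.isClosed_support hsub

lemma PropensityModel.isCompact_indexSet (hm : PropensityModel μ g Λ Par π₀) :
    IsCompact (indexSet μ Par) := by
  have h := (hm.isCompact_suppX.prod hm.par_compact).image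
    (f := fun z : EuclideanSpace ℝ (Fin k) × EuclideanSpace ℝ (Fin k) => (inner ℝ z.1 z.2 : ℝ))
    (by fun_prop)
  convert h using 1
  ext u
  simp only [indexSet, Set.mem_ofPred_eq, Set.mem_image, Set.mem_prod, Prod.exists]
  constructor
  · rintro ⟨x, hx, π, hπ, rfl⟩
    exact ⟨x, π, ⟨hx, hπ⟩, rfl⟩
  · rintro ⟨x, π, ⟨hx, hπ⟩, rfl⟩
    exact ⟨x, hx, π, hπ, rfl⟩

lemma inner_mem_indexSet {x π : EuclideanSpace ℝ (Fin k)} (hx : x ∈ suppX μ) (hπ : π ∈ Par) :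
    inner ℝ x π ∈ indexSet μ Par := ⟨x, hx, π, hπ, rfl⟩

lemma PropensityModel.true_mem_par (hm : PropensityModel μ g Λ Par π₀) : π₀ ∈ Par :=
  interior_subset hm.true_mem

lemma PropensityModel.mem_Ioo (hm : PropensityModel μ g Λ Par π₀) {u : ℝ}
    (hu : u ∈ indexSet μ Par) : Λ u ∈ Set.Ioo (0 : ℝ) 1 := by
  obtain ⟨ε, hε, h⟩ := hm.away_from_zero_one
  have := h u hu
  exact ⟨hε.trans_le this.1, this.2.trans_lt (by linarith)⟩

lemma PropensityModel.continuousOn (hm : PropensityModel μ g Λ Par π₀) :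
    ContinuousOn Λ (indexSet μ Par) :=
  fun u hu => (hm.smooth u hu).continuousAt.continuousWithinAt

lemma PropensityModel.continuousOn_deriv (hm : PropensityModel μ g Λ Par π₀) :
    ContinuousOn (deriv Λ) (indexSet μ Par) := by
  intro u hu
  have h : ContDiffAt ℝ 1 (fderiv ℝ Λ) u := (hm.smooth u hu).fderiv_right (by norm_num)
  have h2 : ContinuousAt (fun v => fderiv ℝ Λ v 1) u := h.continuousAt.clm_apply continuousAt_const
  exact h2.continuousWithinAt

lemma continuousOn_comp_inner {ψ : ℝ → ℝ} (hψ : ContinuousOn ψ (indexSet μ Par)) :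
    ContinuousOn (Function.uncurry fun x π : EuclideanSpace ℝ (Fin k) => ψ (inner ℝ x π))
      (suppX μ ×ˢ Par) := by
  refine hψ.comp (f := fun z : EuclideanSpace ℝ (Fin k) × EuclideanSpace ℝ (Fin k) =>
    (inner ℝ z.1 z.2 : ℝ)) (by fun_prop) fun z hz => ?_
  exact inner_mem_indexSet hz.1 hz.2

/-- The truncation to the support of a function of the index `x'π`. -/
noncomputable def onSupp (μ : Measure (Obs T k)) (ψ : ℝ → ℝ) (π x : EuclideanSpace ℝ (Fin k)) : ℝ :=
  (suppX μ).indicator (fun x => ψ (inner ℝ x π)) x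

/-- Off the index set `ψ` may behave arbitrarily, even non-measurably. Gluing a function continuous
on the closed support with 0 avoids this. -/
lemma measurable_onSupp {ψ : ℝ → ℝ} (hψ : ContinuousOn ψ (indexSet μ Par))
    {π : EuclideanSpace ℝ (Fin k)} (hπ : π ∈ Par) : Measurable (onSupp μ ψ π) := by
  classical
  have hcl : IsClosed (suppX μ) := Measure.isClosed_support
  have hc : ContinuousOn (fun x : EuclideanSpace ℝ (Fin k) => ψ (inner ℝ x π)) (suppX μ) :=
    hψ.comp (by fun_prop) fun x hx => inner_mem_indexSet hx hπ
  have := hc.measurable_piecewise (continuousOn_const (c := (0 : ℝ)) (s := (suppX μ)ᶜ))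
    hcl.measurableSet
  unfold onSupp
  convert! this using 1

lemma exists_bound_onSupp {ψ : ℝ → ℝ} (hK : IsCompact (indexSet μ Par))
    (hψ : ContinuousOn ψ (indexSet μ Par)) :
    ∃ c, ∀ π ∈ Par, ∀ x, |onSupp μ ψ π x| ≤ c := by
  obtain ⟨c, hc⟩ := hK.exists_bound_of_continuousOn hψ
  refine ⟨max c 0, fun π hπ x => ?_⟩
  unfold onSupp
  by_cases hx : x ∈ suppX μ
  · rw [Set.indicator_of_mem hx]
    exact (hc _ (inner_mem_indexSet hx hπ)).trans (le_max_left _ _)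
  · simp [hx]

end Model

/-! ### Consistency of the maximum likelihood estimator -/

/-- From `log x ≤ x - 1` at `x = b / a` one gets `a (log a - log b) ≥ a - b`, strictly unless `a =
b`. For the pairs `(p, q)` and `(1 - p, 1 - q)` the two lower bounds cancel. -/
lemma bernoulli_kl_nonneg {p q : ℝ} (hp : p ∈ Set.Ioo (0 : ℝ) 1) (hq : q ∈ Set.Ioo (0 : ℝ) 1) :
    0 ≤ p * (Real.log p - Real.log q) + (1 - p) * (Real.log (1 - p) - Real.log (1 - q)) ∧
    (p * (Real.log p - Real.log q) + (1 - p) * (Real.log (1 - p) - Real.log (1 - q)) = 0 →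
      p = q) := by
  obtain ⟨hp0, hp1⟩ := hp
  obtain ⟨hq0, hq1⟩ := hq
  have key : ∀ {a b : ℝ}, 0 < a → 0 < b → a - b ≤ a * (Real.log a - Real.log b) ∧
      (a ≠ b → a - b < a * (Real.log a - Real.log b)) := by
    intro a b ha hb
    have hpos : 0 < b / a := by positivity
    have hl : Real.log (b / a) = Real.log b - Real.log a := Real.log_div hb.ne' ha.ne'
    have e : a * (b / a - 1) = b - a := by field_simp
    constructor
    · have := mul_le_mul_of_nonneg_left (Real.log_le_sub_one_of_pos hpos) ha.le
      rw [e, hl] at this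
      linarith
    · intro hab
      have hne : b / a ≠ 1 := fun h => hab ((div_eq_one_iff_eq ha.ne').1 h).symm
      have := mul_lt_mul_of_pos_left (Real.log_lt_sub_one_of_pos hpos hne) ha
      rw [e, hl] at this
      linarith
  have k1 := key hp0 hq0
  have k2 := key (sub_pos.2 hp1) (sub_pos.2 hq1)
  refine ⟨by linarith [k1.1, k2.1], fun h => ?_⟩
  by_contra hne
  linarith [k1.2 hne, k2.1]

section MLE

variable {μ : Measure (Obs T k)} [IsProbabilityMeasure μ] {g : Period T} {Λ : ℝ → ℝ}
  {Par : Set (EuclideanSpace ℝ (Fin k))} {π₀ : EuclideanSpace ℝ (Fin k)}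

/-- The second moment matrix identifies the index. -/
lemma PropensityModel.eq_of_inner_eq (hm : PropensityModel μ g Λ Par π₀)
    (hg : 0 < μ {w | grp g w = 1}) {π : EuclideanSpace ℝ (Fin k)}
    (h : ∀ᵐ w ∂μ, w ∈ groupOrControl g → inner ℝ (covariate w) π = inner ℝ (covariate w) π₀) :
    π = π₀ := by
  have h0 := measure_groupOrControl_pos hg
  have hP : IsProbabilityMeasure (ProbabilityTheory.cond μ (groupOrControl g)) :=
    cond_isProbabilityMeasure h0
  have hae := (ae_cond_iff (measurableSet_groupOrControl g) (measure_ne_top μ _)).2 h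
  have hsupp : ∀ᵐ w ∂(ProbabilityTheory.cond μ (groupOrControl g)), covariate w ∈ suppX μ :=
    (ae_cond_iff (measurableSet_groupOrControl g) (measure_ne_top μ _)).2
      (covariate_mem_suppX.mono fun w hw _ => hw)
  obtain ⟨R, hR⟩ := hm.isCompact_suppX.isBounded.exists_norm_le
  have hint : ∀ a b : Fin k, Integrable (fun w => covariate w a * covariate w b)
      (ProbabilityTheory.cond μ (groupOrControl g)) := by
    intro a b
    have hma : ∀ a : Fin k, Measurable fun w : Obs T k => covariate w a := fun a => by
      have := measurable_covariate (T := T) (k := k)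
      fun_prop
    refine Integrable.of_bound ((hma a).mul (hma b)).aestronglyMeasurable (R * R) ?_
    filter_upwards [hsupp] with w hw
    have hb : ∀ a : Fin k, ‖covariate w a‖ ≤ R := fun a =>
      (PiLp.norm_apply_le (covariate w) a).trans (hR _ hw)
    rw [norm_mul]
    exact mul_le_mul (hb a) (hb b) (norm_nonneg _) ((norm_nonneg _).trans (hb a))
  by_contra hne
  have hd : (fun a => π a - π₀ a) ≠ 0 := by
    intro h
    apply hne
    ext a
    have := congrFun h a
    simpa [sub_eq_zero] using this
  have hpos := hm.secondMoment_posDef.dotProduct_mulVec_pos hd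
  -- The quadratic form of the second moment matrix at `π - π₀` is the conditional mean of `(X'π -
  -- X'π₀)²`, which vanishes by hypothesis.
  have hzero : (fun a => π a - π₀ a) ⬝ᵥ (Matrix.of fun a b : Fin k =>
      ∫ w, covariate w a * covariate w b ∂(ProbabilityTheory.cond μ (groupOrControl g)))
        *ᵥ (fun a => π a - π₀ a) = 0 := by
    have e : ∀ w : Obs T k, ∑ a, ∑ b, (π a - π₀ a) * (π b - π₀ b)
        * (covariate w a * covariate w b) = (inner ℝ (covariate w) π
          - inner ℝ (covariate w) π₀) ^ 2 := by
      intro w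
      rw [← inner_sub_right, PiLp.inner_apply, sq, Finset.sum_mul_sum]
      refine Finset.sum_congr rfl fun a _ => Finset.sum_congr rfl fun b _ => ?_
      simp
      ring
    rw [dotProduct_mulVec_integral hint]
    simp_rw [e]
    refine integral_eq_zero_of_ae ?_
    filter_upwards [hae] with w hw
    simp [hw]
  rw [star_trivial, hzero] at hpos
  exact lt_irrefl _ hpos

lemma integrable_mul_onSupp {ψ : ℝ → ℝ} (hK : IsCompact (indexSet μ Par))
    (hψ : ContinuousOn ψ (indexSet μ Par)) {π : EuclideanSpace ℝ (Fin k)} (hπ : π ∈ Par)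
    {a : Obs T k → ℝ} (ham : Measurable a) (ha : ∀ w, |a w| ≤ 1) :
    Integrable (fun w => a w * onSupp μ ψ π (covariate w)) μ := by
  obtain ⟨c, hc⟩ := exists_bound_onSupp hK hψ
  refine Integrable.of_bound (ham.mul ((measurable_onSupp hψ hπ).comp
    measurable_covariate)).aestronglyMeasurable (1 * c) (Eventually.of_forall fun w => ?_)
  rw [norm_mul]
  exact mul_le_mul (ha w) (hc π hπ _) (norm_nonneg _) zero_le_one

omit [IsProbabilityMeasure μ] in
lemma PropensityModel.continuousOn_log (hm : PropensityModel μ g Λ Par π₀) :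
    ContinuousOn (fun u => Real.log (Λ u)) (indexSet μ Par) :=
  hm.continuousOn.log fun _ hu => (hm.mem_Ioo hu).1.ne'

omit [IsProbabilityMeasure μ] in
lemma PropensityModel.continuousOn_log_one_sub (hm : PropensityModel μ g Λ Par π₀) :
    ContinuousOn (fun u => Real.log (1 - Λ u)) (indexSet μ Par) :=
  (continuousOn_const.sub hm.continuousOn).log fun _ hu => (sub_pos.2 (hm.mem_Ioo hu).2).ne'

/-- The expected log-likelihood is uniquely maximal at the true parameter. -/
lemma PropensityModel.expected_logLik_lt (hm : PropensityModel μ g Λ Par π₀)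
    (hg : 0 < μ {w | grp g w = 1}) {π : EuclideanSpace ℝ (Fin k)} (hπ : π ∈ Par) (hne : π ≠ π₀) :
    ∫ w, grp g w * Real.log (Λ (inner ℝ (covariate w) π)) ∂μ
        + ∫ w, ctrl w * Real.log (1 - Λ (inner ℝ (covariate w) π)) ∂μ
      < ∫ w, grp g w * Real.log (Λ (inner ℝ (covariate w) π₀)) ∂μ
        + ∫ w, ctrl w * Real.log (1 - Λ (inner ℝ (covariate w) π₀)) ∂μ := by
  have hK := hm.isCompact_indexSet
  have hc1 := hm.continuousOn_log
  have hc2 := hm.continuousOn_log_one_sub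
  have hπ₀ := hm.true_mem_par
  set ψ₁ : ℝ → ℝ := fun u => Real.log (Λ u)
  set ψ₂ : ℝ → ℝ := fun u => Real.log (1 - Λ u)
  have hsupp := covariate_mem_suppX (μ := μ)
  have hrepl : ∀ (ψ : ℝ → ℝ) (a : Obs T k → ℝ) (π : EuclideanSpace ℝ (Fin k)),
      ∫ w, a w * ψ (inner ℝ (covariate w) π) ∂μ = ∫ w, a w * onSupp μ ψ π (covariate w) ∂μ := by
    intro ψ a π
    refine integral_congr_ae ?_
    filter_upwards [hsupp] with w hw
    simp only [onSupp]
    rw [Set.indicator_of_mem hw]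
  have i1 := fun {π} (h : π ∈ Par) => integrable_mul_onSupp hK hc1 h (measurable_grp g) (abs_grp_le g)
  have i2 := fun {π} (h : π ∈ Par) => integrable_mul_onSupp hK hc2 h measurable_ctrl abs_ctrl_le
  have i3 := fun {π} (h : π ∈ Par) => integrable_mul_onSupp hK hc2 h (measurable_grp g) (abs_grp_le g)
  obtain ⟨c₁, hb1⟩ := exists_bound_onSupp hK hc1
  obtain ⟨c₂, hb2⟩ := exists_bound_onSupp hK hc2
  -- `A` and `B` are the log-likelihood gains of `π₀` over `π` for a treated and for a control unit.
  let A : EuclideanSpace ℝ (Fin k) → ℝ := fun x => onSupp μ ψ₁ π₀ x - onSupp μ ψ₁ π x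
  let B : EuclideanSpace ℝ (Fin k) → ℝ := fun x => onSupp μ ψ₂ π₀ x - onSupp μ ψ₂ π x
  have hAm : Measurable A := (measurable_onSupp hc1 hπ₀).sub (measurable_onSupp hc1 hπ)
  have hBm : Measurable B := (measurable_onSupp hc2 hπ₀).sub (measurable_onSupp hc2 hπ)
  have hAB : ∀ x, |A x - B x| ≤ (c₁ + c₁) + (c₂ + c₂) := fun x =>
    (abs_sub _ _).trans (add_le_add
      ((abs_sub _ _).trans (add_le_add (hb1 _ hπ₀ x) (hb1 _ hπ x)))
      ((abs_sub _ _).trans (add_le_add (hb2 _ hπ₀ x) (hb2 _ hπ x))))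
  have hps := (ae_cond_iff (measurableSet_groupOrControl g) (measure_ne_top μ _)).1 hm.model
  -- On `G_g + C = 1`, `D` is the Kullback–Leibler divergence between the Bernoulli laws at the two
  -- indices. It arises from `G A + C B = G (A - B) + (G + C) B` after `G` is replaced in
  -- expectation by `(G + C) p_g(X)`.
  let D : Obs T k → ℝ := fun w => (grp g w + ctrl w) *
    (Λ (inner ℝ (covariate w) π₀) * A (covariate w)
      + (1 - Λ (inner ℝ (covariate w) π₀)) * B (covariate w))
  have hDae : (fun w => (grp g w + ctrl w) * (pscore μ g w * (A (covariate w) - B (covariate w)))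
      + (grp g w + ctrl w) * B (covariate w)) =ᵐ[μ] D := by
    filter_upwards [hps] with w hw
    by_cases hgc : w ∈ groupOrControl g
    · rw [hw hgc]
      simp only [D]
      ring
    · have : grp g w + ctrl w = 0 := by
        rw [grp_add_ctrl_eq_indicator]; simp [hgc]
      simp [D, this]
  have jB : Integrable (fun w => (grp g w + ctrl w) * B (covariate w)) μ := by
    have := ((i3 hπ₀).sub (i3 hπ)).add ((i2 hπ₀).sub (i2 hπ))
    refine this.congr (Eventually.of_forall fun w => ?_)
    simp only [Pi.add_apply, Pi.sub_apply, B]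
    ring
  have jG : Integrable (fun w => grp g w * (A (covariate w) - B (covariate w))) μ := by
    have := ((i1 hπ₀).sub (i1 hπ)).sub ((i3 hπ₀).sub (i3 hπ))
    refine this.congr (Eventually.of_forall fun w => ?_)
    simp only [Pi.sub_apply, A, B]
    ring
  have hcm : Measurable fun w : Obs T k => A (covariate w) - B (covariate w) :=
    (hAm.sub hBm).comp measurable_covariate
  have jP : Integrable (fun w => (grp g w + ctrl w) *
      (pscore μ g w * (A (covariate w) - B (covariate w)))) μ := by
    have hmeas : AEStronglyMeasurable (pscore μ g) μ :=
      (stronglyMeasurable_condExp.mono (measurable_covariate.comap_le)).aestronglyMeasurable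
    refine Integrable.of_bound ((((measurable_grp g).add
      measurable_ctrl).aestronglyMeasurable).mul (hmeas.mul hcm.aestronglyMeasurable))
      (1 * (1 * ((c₁ + c₁) + (c₂ + c₂)))) ?_
    filter_upwards [hps] with w hw
    rw [norm_mul, norm_mul]
    by_cases hgc : w ∈ groupOrControl g
    · have h1 : ‖grp g w + ctrl w‖ ≤ 1 := by
        rw [grp_add_ctrl_eq_indicator]; simp [hgc]
      have h2 : ‖pscore μ g w‖ ≤ 1 := by
        rw [hw hgc, Real.norm_eq_abs, abs_le]
        have := hm.range_mem (inner ℝ (covariate w) π₀)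
        constructor <;> linarith [this.1, this.2]
      exact mul_le_mul h1 (mul_le_mul h2 (hAB _) (norm_nonneg _) zero_le_one)
        (by positivity) zero_le_one
    · have : grp g w + ctrl w = 0 := by
        rw [grp_add_ctrl_eq_indicator]; simp [hgc]
      rw [this, norm_zero, zero_mul]
      have := (abs_nonneg _).trans (hAB 0)
      linarith
  have hDi : Integrable D μ := (jP.add jB).congr hDae
  have hdiff : (∫ w, grp g w * Real.log (Λ (inner ℝ (covariate w) π₀)) ∂μ
        + ∫ w, ctrl w * Real.log (1 - Λ (inner ℝ (covariate w) π₀)) ∂μ)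
      - (∫ w, grp g w * Real.log (Λ (inner ℝ (covariate w) π)) ∂μ
        + ∫ w, ctrl w * Real.log (1 - Λ (inner ℝ (covariate w) π)) ∂μ) = ∫ w, D w ∂μ := by
    have hG := integral_grp_mul hg (h := fun x => A x - B x) (hAm.sub hBm) hAB
    rw [hrepl ψ₁ (grp g) π₀, hrepl ψ₁ (grp g) π, hrepl ψ₂ ctrl π₀, hrepl ψ₂ ctrl π,
      ← integral_congr_ae hDae, integral_add jP jB, ← hG,
      ← integral_add jG jB, ← integral_add (i1 hπ₀) (i2 hπ₀), ← integral_add (i1 hπ) (i2 hπ)]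
    refine (integral_sub ((i1 hπ₀).add (i2 hπ₀)) ((i1 hπ).add (i2 hπ))).symm.trans ?_
    refine integral_congr_ae (Eventually.of_forall fun w => ?_)
    simp only [A, B, Pi.add_apply]
    ring
  have hkl : ∀ᵐ w ∂μ, 0 ≤ D w ∧ (D w = 0 → w ∈ groupOrControl g →
      inner ℝ (covariate w) π = inner ℝ (covariate w) π₀) := by
    filter_upwards [hsupp] with w hw
    have m0 := inner_mem_indexSet hw hπ₀
    have m1 := inner_mem_indexSet hw hπ
    have hk := bernoulli_kl_nonneg (hm.mem_Ioo m0) (hm.mem_Ioo m1)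
    have hD : D w = (grp g w + ctrl w) * (Λ (inner ℝ (covariate w) π₀) *
        (Real.log (Λ (inner ℝ (covariate w) π₀)) - Real.log (Λ (inner ℝ (covariate w) π)))
        + (1 - Λ (inner ℝ (covariate w) π₀)) * (Real.log (1 - Λ (inner ℝ (covariate w) π₀))
          - Real.log (1 - Λ (inner ℝ (covariate w) π)))) := by
      simp only [D, A, B, onSupp]
      rw [Set.indicator_of_mem hw, Set.indicator_of_mem hw, Set.indicator_of_mem hw,
        Set.indicator_of_mem hw]
    constructor
    · rw [hD]
      refine mul_nonneg ?_ hk.1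
      rcases grp_ctrl_cases g w with h | h | h <;> simp [h]
    · intro h0 hgc
      rw [hD, show grp g w + ctrl w = 1 from hgc, one_mul] at h0
      -- Zero divergence gives equal probabilities, and strict monotonicity of `Λ` turns these into
      -- equal indices.
      exact (hm.strictMono.injOn m0 m1 (hk.2 h0)).symm
  have hnn : 0 ≤ ∫ w, D w ∂μ := integral_nonneg_of_ae (hkl.mono fun w hw => hw.1)
  rcases hnn.lt_or_eq with hlt | heq
  · linarith
  · exfalso
    have hz := (integral_eq_zero_iff_of_nonneg_ae (hkl.mono fun w hw => hw.1) hDi).1 heq.symm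
    refine hne (hm.eq_of_inner_eq hg ?_)
    filter_upwards [hkl, hz] with w hw hw0
    exact hw.2 hw0

omit [IsProbabilityMeasure μ] in
lemma logLik_eq_sampleMean {n : ℕ} (s : Fin n → Obs T k) (g : Period T) (Λ : ℝ → ℝ)
    (π : EuclideanSpace ℝ (Fin k)) :
    (n : ℝ)⁻¹ * logLik s g Λ π =
      sampleMean s (fun w => grp g w * Real.log (Λ (inner ℝ (covariate w) π)))
        + sampleMean s (fun w => ctrl w * Real.log (1 - Λ (inner ℝ (covariate w) π))) := by
  unfold logLik sampleMean
  rw [← mul_add, ← Finset.sum_add_distrib, Finset.sum_filter]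
  congr 1
  refine Finset.sum_congr rfl fun i _ => ?_
  rcases grp_ctrl_cases g (s i) with h | h | h <;> simp [h]

/-- Strong consistency of the maximum likelihood estimator. -/
lemma PropensityModel.tendsto_mle (hm : PropensityModel μ g Λ Par π₀)
    (hg : 0 < μ {w | grp g w = 1}) {Ω : Type*} [MeasurableSpace Ω] {P : Measure Ω}
    {W : ℕ → Ω → Obs T k} (hWm : ∀ i, Measurable (W i)) (hWind : iIndepFun W P)
    (hWlaw : ∀ i, P.map (W i) = μ) {πhat : ℕ → Ω → EuclideanSpace ℝ (Fin k)}
    (hπ : ∀ n, ∀ᵐ ω ∂P, IsMLE (firstN W n ω) g Λ Par (πhat n ω)) :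
    ∀ᵐ ω ∂P, Tendsto (fun n => πhat n ω) atTop (𝓝 π₀) := by
  have hcK : CompactSpace Par := isCompact_iff_compactSpace.1 hm.par_compact
  -- The likelihood is split into its treated and control parts, so that each is a bounded function
  -- of `W` times a continuous function of the index. On the subpopulation `1 - G_g = C`.
  obtain ⟨F₁, hF₁, h1⟩ := uniform_sampleMean (P := P) (K := Par) hWm hWind hWlaw
    hm.isCompact_suppX (measurable_grp g) (abs_grp_le g) (continuousOn_comp_inner hm.continuousOn_log)
  obtain ⟨F₂, hF₂, h2⟩ := uniform_sampleMean (P := P) (K := Par) hWm hWind hWlaw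
    hm.isCompact_suppX measurable_ctrl abs_ctrl_le
    (continuousOn_comp_inner hm.continuousOn_log_one_sub)
  filter_upwards [h1, h2, ae_all_iff.2 hπ] with ω ⟨G₁, hG₁, t1⟩ ⟨G₂, hG₂, t2⟩ hmle
  have hlim : Tendsto (fun n => (⟨πhat n ω, (hmle n).1⟩ : Par)) atTop
      (𝓝 ⟨π₀, hm.true_mem_par⟩) := by
    refine tendsto_of_isMax (t1.add t2) (fun π hne => ?_) fun n => ?_
    · simp only [ContinuousMap.add_apply, hF₁, hF₂]
      exact hm.expected_logLik_lt hg π.2 fun h => hne (Subtype.ext h)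
    · simp only [ContinuousMap.add_apply, hG₁, hG₂, ← logLik_eq_sampleMean]
      exact mul_le_mul_of_nonneg_left ((hmle n).2 hm.true_mem_par) (by positivity)
  exact (continuous_subtype_val.tendsto _).comp hlim

end MLE


/-! ### Weighted uniform convergence -/

/-- `f n → h` uniformly on `S` relative to the weight `H`, and `h` is of the order of `H`. -/
structure WeightedUnif {α : Type*} (S : Set α) (H : α → ℝ) (f : ℕ → α → ℝ) (h : α → ℝ) : Prop where
  approx : ∀ δ : ℝ, 0 < δ → ∀ᶠ n in atTop, ∀ w ∈ S, |f n w - h w| ≤ δ * H w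
  bound : ∃ B : ℝ, 0 ≤ B ∧ ∀ w ∈ S, |h w| ≤ B * H w

namespace WeightedUnif

variable {α : Type*} {S : Set α} {H H₁ H₂ : α → ℝ} {f f₁ f₂ : ℕ → α → ℝ} {h h₁ h₂ : α → ℝ}

lemma of_fixed {B : ℝ} (hB : 0 ≤ B) (hH : ∀ w ∈ S, 0 ≤ H w) (hb : ∀ w ∈ S, |h w| ≤ B * H w) :
    WeightedUnif S H (fun _ => h) h :=
  ⟨fun δ hδ => Eventually.of_forall fun n w hw => by
    simpa using mul_nonneg hδ.le (hH w hw), B, hB, hb⟩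

lemma of_tendsto {c : ℕ → ℝ} {c₀ : ℝ} (hc : Tendsto c atTop (𝓝 c₀)) :
    WeightedUnif S (fun _ => 1) (fun n _ => c n) (fun _ => c₀) := by
  refine ⟨fun δ hδ => ?_, |c₀|, abs_nonneg _, fun w _ => by simp⟩
  filter_upwards [(Metric.tendsto_nhds.1 hc) δ hδ] with n hn w _
  rw [Real.dist_eq] at hn
  simpa using hn.le

lemma mono (hf : WeightedUnif S H₁ f h) (hH : ∀ w ∈ S, H₁ w ≤ H₂ w) : WeightedUnif S H₂ f h := by
  obtain ⟨B, hB, hb⟩ := hf.bound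
  refine ⟨fun δ hδ => ?_, B, hB, fun w hw =>
    (hb w hw).trans (mul_le_mul_of_nonneg_left (hH w hw) hB)⟩
  filter_upwards [hf.approx δ hδ] with n hn w hw
  exact (hn w hw).trans (mul_le_mul_of_nonneg_left (hH w hw) hδ.le)

lemma add (hf : WeightedUnif S H f₁ h₁) (hg : WeightedUnif S H f₂ h₂) :
    WeightedUnif S H (fun n w => f₁ n w + f₂ n w) (fun w => h₁ w + h₂ w) := by
  obtain ⟨B₁, hB₁, hb₁⟩ := hf.bound
  obtain ⟨B₂, hB₂, hb₂⟩ := hg.bound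
  refine ⟨fun δ hδ => ?_, B₁ + B₂, add_nonneg hB₁ hB₂, fun w hw => ?_⟩
  · filter_upwards [hf.approx (δ / 2) (by positivity), hg.approx (δ / 2) (by positivity)]
      with n h1 h2 w hw
    have e : f₁ n w + f₂ n w - (h₁ w + h₂ w) = (f₁ n w - h₁ w) + (f₂ n w - h₂ w) := by ring
    rw [e]
    refine (abs_add_le _ _).trans ((add_le_add (h1 w hw) (h2 w hw)).trans (le_of_eq ?_))
    ring
  · refine (abs_add_le _ _).trans ((add_le_add (hb₁ w hw) (hb₂ w hw)).trans (le_of_eq ?_))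
    ring

/-- Weights multiply. Two cases are used: bounded times envelope-sized functions, and squares of
envelope-sized functions, where the weight is the integrable squared envelope. -/
lemma mul (hf : WeightedUnif S H₁ f₁ h₁) (hg : WeightedUnif S H₂ f₂ h₂) :
    WeightedUnif S (fun w => H₁ w * H₂ w) (fun n w => f₁ n w * f₂ n w)
      (fun w => h₁ w * h₂ w) := by
  obtain ⟨B₁, hB₁, hb₁⟩ := hf.bound
  obtain ⟨B₂, hB₂, hb₂⟩ := hg.bound
  refine ⟨fun δ hδ => ?_, B₁ * B₂, mul_nonneg hB₁ hB₂, fun w hw => ?_⟩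
  · have hc : 0 < B₁ + B₂ + 1 := by positivity
    -- The error is at most `η² + η B₂ + η B₁` times the weight. The cap `η ≤ 1` gives `η² ≤ η`, so
    -- `η (B₁ + B₂ + 1) ≤ δ` suffices.
    have hη : 0 < min 1 (δ / (B₁ + B₂ + 1)) := lt_min one_pos (by positivity)
    filter_upwards [hf.approx _ hη, hg.approx _ hη] with n h1 h2 w hw
    set η := min 1 (δ / (B₁ + B₂ + 1)) with hηd
    have e : f₁ n w * f₂ n w - h₁ w * h₂ w = (f₁ n w - h₁ w) * (f₂ n w - h₂ w)
        + (f₁ n w - h₁ w) * h₂ w + h₁ w * (f₂ n w - h₂ w) := by ring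
    have n1 : 0 ≤ η * H₁ w := (abs_nonneg _).trans (h1 w hw)
    have n2 : 0 ≤ η * H₂ w := (abs_nonneg _).trans (h2 w hw)
    have p1 : 0 ≤ H₁ w := nonneg_of_mul_nonneg_right n1 hη
    have p2 : 0 ≤ H₂ w := nonneg_of_mul_nonneg_right n2 hη
    have a1 : |(f₁ n w - h₁ w) * (f₂ n w - h₂ w)| ≤ (η * H₁ w) * (η * H₂ w) := by
      rw [abs_mul]; exact mul_le_mul (h1 w hw) (h2 w hw) (abs_nonneg _) n1
    have a2 : |(f₁ n w - h₁ w) * h₂ w| ≤ (η * H₁ w) * (B₂ * H₂ w) := by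
      rw [abs_mul]; exact mul_le_mul (h1 w hw) (hb₂ w hw) (abs_nonneg _) n1
    have a3 : |h₁ w * (f₂ n w - h₂ w)| ≤ (B₁ * H₁ w) * (η * H₂ w) := by
      rw [abs_mul]; exact mul_le_mul (hb₁ w hw) (h2 w hw) (abs_nonneg _) (by positivity)
    have hηη : η * η ≤ η := mul_le_of_le_one_left hη.le (min_le_left _ _)
    have hηδ : η * (B₁ + B₂ + 1) ≤ δ := by
      have : η ≤ δ / (B₁ + B₂ + 1) := min_le_right _ _
      rwa [le_div_iff₀ hc] at this
    rw [e]
    calc _ ≤ (η * H₁ w) * (η * H₂ w) + (η * H₁ w) * (B₂ * H₂ w) + (B₁ * H₁ w) * (η * H₂ w) :=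
          (abs_add_le _ _).trans (add_le_add ((abs_add_le _ _).trans (add_le_add a1 a2)) a3)
      _ = (η * η + η * B₂ + η * B₁) * (H₁ w * H₂ w) := by ring
      _ ≤ δ * (H₁ w * H₂ w) := by
          refine mul_le_mul_of_nonneg_right ?_ (mul_nonneg p1 p2)
          linarith
  · rw [abs_mul]
    refine (mul_le_mul (hb₁ w hw) (hb₂ w hw) (abs_nonneg _)
      ((abs_nonneg _).trans (hb₁ w hw))).trans (le_of_eq ?_)
    ring

lemma bdd_mul (hf : WeightedUnif S (fun _ => 1) f₁ h₁) (hg : WeightedUnif S H f₂ h₂) :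
    WeightedUnif S H (fun n w => f₁ n w * f₂ n w) (fun w => h₁ w * h₂ w) := by
  simpa using hf.mul hg

lemma const_mul {c : ℕ → ℝ} {c₀ : ℝ} (hc : Tendsto c atTop (𝓝 c₀)) (hf : WeightedUnif S H f h) :
    WeightedUnif S H (fun n w => c n * f n w) (fun w => c₀ * h w) :=
  (of_tendsto hc).bdd_mul hf

lemma neg (hf : WeightedUnif S H f h) : WeightedUnif S H (fun n w => -f n w) (fun w => -h w) := by
  simpa using hf.const_mul (tendsto_const_nhds (x := (-1 : ℝ)))

lemma sub (hf : WeightedUnif S H f₁ h₁) (hg : WeightedUnif S H f₂ h₂) :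
    WeightedUnif S H (fun n w => f₁ n w - f₂ n w) (fun w => h₁ w - h₂ w) := by
  simpa [sub_eq_add_neg] using hf.add hg.neg

lemma sum {ι : Type*} (s : Finset ι) {F : ι → ℕ → α → ℝ} {h : ι → α → ℝ}
    (hH : ∀ w ∈ S, 0 ≤ H w) (hF : ∀ i ∈ s, WeightedUnif S H (F i) (h i)) :
    WeightedUnif S H (fun n w => ∑ i ∈ s, F i n w) (fun w => ∑ i ∈ s, h i w) := by
  classical
  induction s using Finset.induction_on with
  | empty => simpa using of_fixed (h := fun _ => 0) le_rfl hH (by simp)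
  | insert j s hj ih =>
    simp only [Finset.sum_insert hj]
    exact (hF j (Finset.mem_insert_self _ _)).add
      (ih fun i hi => hF i (Finset.mem_insert_of_mem hi))

end WeightedUnif

/-- The two averages differ by at most `δ` times the average of `H`, which is eventually bounded
because it converges. This is how estimated nuisance functions are replaced by their limits inside
sample means. -/
lemma WeightedUnif.tendsto_sampleMean {S : Set (Obs T k)} {H h : Obs T k → ℝ}
    {f : ℕ → Obs T k → ℝ} (hf : WeightedUnif S H f h) {s : (n : ℕ) → Fin n → Obs T k}
    (hs : ∀ n i, s n i ∈ S) {L M : ℝ} (hH : Tendsto (fun n => sampleMean (s n) H) atTop (𝓝 M))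
    (hh : Tendsto (fun n => sampleMean (s n) h) atTop (𝓝 L)) :
    Tendsto (fun n => sampleMean (s n) (f n)) atTop (𝓝 L) := by
  have hd : Tendsto (fun n => sampleMean (s n) (f n) - sampleMean (s n) h) atTop (𝓝 0) := by
    rw [Metric.tendsto_nhds]
    intro ε hε
    have hc : 0 < |M| + 1 := by positivity
    filter_upwards [hf.approx (ε / (2 * (|M| + 1))) (by positivity),
      hH.eventually (gt_mem_nhds (show M < |M| + 1 by linarith [le_abs_self M]))] with n h1 h2
    rw [Real.dist_eq, sub_zero]
    have e : sampleMean (s n) (f n) - sampleMean (s n) h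
        = (n : ℝ)⁻¹ * ∑ i, (f n (s n i) - h (s n i)) := by
      simp only [sampleMean, Finset.sum_sub_distrib]
      ring
    have hn : (0 : ℝ) ≤ (n : ℝ)⁻¹ := by positivity
    calc |sampleMean (s n) (f n) - sampleMean (s n) h|
        = (n : ℝ)⁻¹ * |∑ i, (f n (s n i) - h (s n i))| := by
          rw [e, abs_mul, abs_of_nonneg hn]
      _ ≤ (n : ℝ)⁻¹ * ∑ i, ε / (2 * (|M| + 1)) * H (s n i) :=
          mul_le_mul_of_nonneg_left ((Finset.abs_sum_le_sum_abs _ _).trans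
            (Finset.sum_le_sum fun i _ => h1 _ (hs n i))) hn
      _ = ε / (2 * (|M| + 1)) * sampleMean (s n) H := by
          rw [← Finset.mul_sum, sampleMean]; ring
      _ ≤ ε / (2 * (|M| + 1)) * (|M| + 1) := by
          refine mul_le_mul_of_nonneg_left h2.le (by positivity)
      _ = ε / 2 := by field_simp
      _ < ε := by linarith
  simpa using hd.add hh

lemma tendsto_matrix_inv {ι : Type*} [Fintype ι] [DecidableEq ι] {A : ℕ → Matrix ι ι ℝ}
    {A₀ : Matrix ι ι ℝ} (hA : Tendsto A atTop (𝓝 A₀)) (hdet : A₀.det ≠ 0) :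
    Tendsto (fun n => (A n)⁻¹) atTop (𝓝 A₀⁻¹) := by
  simp only [Matrix.inv_def, Ring.inverse_eq_inv']
  have h1 : Tendsto (fun n => (A n).det) atTop (𝓝 A₀.det) :=
    ((continuous_id.matrix_det).tendsto A₀).comp hA
  have h2 : Tendsto (fun n => (A n).adjugate) atTop (𝓝 A₀.adjugate) :=
    ((continuous_id.matrix_adjugate).tendsto A₀).comp hA
  exact (h1.inv₀ hdet).smul h2

/-! ### Convergence of the estimated influence functions along a sample path -/

section Path

variable {S : Set (Obs T k)} {H : Obs T k → ℝ} {s : (n : ℕ) → Fin n → Obs T k}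
  {E : (Obs T k → ℝ) → ℝ} {g t : Period T} {p dp : Obs T k → ℝ} {ph dph : ℕ → Obs T k → ℝ}

lemma weightedUnif_grp : WeightedUnif S (fun _ => 1) (fun _ => grp g) (grp g) :=
  .of_fixed zero_le_one (by simp) fun w _ => by simpa using abs_grp_le g w

lemma weightedUnif_ctrl : WeightedUnif S (fun _ => 1) (fun _ => ctrl) ctrl :=
  .of_fixed zero_le_one (by simp) fun w _ => by simpa using abs_ctrl_le w

lemma weightedUnif_oddsWeight (hp : WeightedUnif S (fun _ => 1) ph p)
    (hq : WeightedUnif S (fun _ => 1) (fun n w => (1 - ph n w)⁻¹) fun w => (1 - p w)⁻¹) :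
    WeightedUnif S (fun _ => 1) (fun n => oddsWeight (ph n)) (oddsWeight p) := by
  have h := (hp.bdd_mul (weightedUnif_ctrl (T := T) (k := k))).bdd_mul hq
  simp only [← div_eq_mul_inv] at h
  exact h

lemma weightedUnif_weightG (h0 : E (grp g) ≠ 0)
    (hG : Tendsto (fun n => sampleMean (s n) (grp g)) atTop (𝓝 (E (grp g)))) :
    WeightedUnif S (fun _ => 1) (fun n => weightG (sampleMean (s n)) g) (weightG E g) := by
  have h := (weightedUnif_grp (S := S) (g := g)).bdd_mul (.of_tendsto (hG.inv₀ h0))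
  simp only [← div_eq_mul_inv] at h
  exact h

lemma weightedUnif_weightC (hp : WeightedUnif S (fun _ => 1) (fun n => oddsWeight (ph n))
      (oddsWeight p)) (h0 : E (oddsWeight p) ≠ 0)
    (hC : Tendsto (fun n => sampleMean (s n) (oddsWeight (ph n))) atTop (𝓝 (E (oddsWeight p)))) :
    WeightedUnif S (fun _ => 1) (fun n => weightC (sampleMean (s n)) (ph n)) (weightC E p) := by
  have h := hp.bdd_mul (.of_tendsto (hC.inv₀ h0))
  simp only [← div_eq_mul_inv] at h
  exact h

/-- Along the sample path `s`, the influence function of the estimator of `ATT(g,t)` with estimated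
nuisance parameters converges uniformly relative to `H`. -/
lemma weightedUnif_psi (hs : ∀ n i, s n i ∈ S) (hH1 : ∀ w ∈ S, 1 ≤ H w)
    (hD : WeightedUnif S H (fun _ => longDiff g t) (longDiff g t))
    (hX : ∀ a : Fin k, WeightedUnif S (fun _ => 1) (fun _ w => covariate w a)
      fun w => covariate w a)
    (hp : WeightedUnif S (fun _ => 1) ph p) (hdp : WeightedUnif S (fun _ => 1) dph dp)
    (hq : WeightedUnif S (fun _ => 1) (fun n w => (1 - ph n w)⁻¹) fun w => (1 - p w)⁻¹)
    (hpq : WeightedUnif S (fun _ => 1) (fun n w => (ph n w * (1 - ph n w))⁻¹)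
      fun w => (p w * (1 - p w))⁻¹)
    (hG0 : E (grp g) ≠ 0) (hC0 : E (oddsWeight p) ≠ 0) (hI0 : (infoMatrix E g p dp).det ≠ 0)
    (lH : Tendsto (fun n => sampleMean (s n) H) atTop (𝓝 (E H)))
    (lG : Tendsto (fun n => sampleMean (s n) (grp g)) atTop (𝓝 (E (grp g))))
    (lGD : Tendsto (fun n => sampleMean (s n) fun w => weightG E g w * longDiff g t w) atTop
      (𝓝 (E fun w => weightG E g w * longDiff g t w)))
    (lC : Tendsto (fun n => sampleMean (s n) (oddsWeight p)) atTop (𝓝 (E (oddsWeight p))))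
    (lCD : Tendsto (fun n => sampleMean (s n) fun w => weightC E p w * longDiff g t w) atTop
      (𝓝 (E fun w => weightC E p w * longDiff g t w)))
    (lI : ∀ a b : Fin k, Tendsto (fun n => sampleMean (s n) fun w =>
        (grp g w + ctrl w) * dp w ^ 2 / (p w * (1 - p w)) * (covariate w a * covariate w b)) atTop
      (𝓝 (infoMatrix E g p dp a b)))
    (lM : ∀ a : Fin k, Tendsto (fun n => sampleMean (s n) fun w =>
        covariate w a * (ctrl w / (1 - p w)) ^ 2 * dp w *
          (longDiff g t w - E fun v => weightC E p v * longDiff g t v)) atTop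
      (𝓝 (E fun w => covariate w a * (ctrl w / (1 - p w)) ^ 2 * dp w *
          (longDiff g t w - E fun v => weightC E p v * longDiff g t v)))) :
    WeightedUnif S H
      (fun n w => psiG (sampleMean (s n)) g t w - psiC (sampleMean (s n)) g t (ph n) (dph n) w)
      (fun w => psiG E g t w - psiC E g t p dp w) := by
  -- As the envelope is at least 1, bounded and envelope-sized terms can share one weight. Below,
  -- each converging sample mean becomes a converging coefficient of the next expression: weights,
  -- centring constants, information matrix, score, `M_gt`.
  have toH : ∀ {f : ℕ → Obs T k → ℝ} {h : Obs T k → ℝ}, WeightedUnif S (fun _ => 1) f h →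
      WeightedUnif S H f h := fun hf => hf.mono hH1
  have hwG := weightedUnif_weightG (S := S) hG0 lG
  have mG := (hwG.bdd_mul hD).tendsto_sampleMean hs lH lGD
  have hψG := hwG.bdd_mul (hD.sub (toH (.of_tendsto mG)))
  have hodds := weightedUnif_oddsWeight hp hq
  have modds := (toH hodds).tendsto_sampleMean hs lH lC
  have hwC := weightedUnif_weightC hodds hC0 modds
  have mC := (hwC.bdd_mul hD).tendsto_sampleMean hs lH lCD
  have hDm := hD.sub (toH (.of_tendsto mC))
  have hGC := (weightedUnif_grp (S := S) (g := g)).add (weightedUnif_ctrl (S := S))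
  have hinfo : ∀ a b, Tendsto (fun n => infoMatrix (sampleMean (s n)) g (ph n) (dph n) a b) atTop
      (𝓝 (infoMatrix E g p dp a b)) := by
    intro a b
    have h := ((hGC.bdd_mul (hdp.bdd_mul hdp)).bdd_mul hpq).bdd_mul ((hX a).bdd_mul (hX b))
    simp only [← div_eq_mul_inv, ← sq] at h
    exact (toH h).tendsto_sampleMean hs lH (lI a b)
  have hinv := tendsto_matrix_inv (tendsto_pi_nhds.2 fun a => tendsto_pi_nhds.2 fun b => hinfo a b) hI0
  have hscore : ∀ b : Fin k, WeightedUnif S (fun _ => 1) (fun n w => covariate w b *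
      ((grp g w + ctrl w) * (grp g w - ph n w) * dph n w / (ph n w * (1 - ph n w))))
      (fun w => covariate w b *
      ((grp g w + ctrl w) * (grp g w - p w) * dp w / (p w * (1 - p w)))) := by
    intro b
    have h := (hX b).bdd_mul
      (((hGC.bdd_mul ((weightedUnif_grp (g := g)).sub hp)).bdd_mul hdp).bdd_mul hpq)
    simpa only [← div_eq_mul_inv] using h
  have hξ : ∀ a : Fin k, WeightedUnif S (fun _ => 1)
      (fun n w => scoreInfluence (sampleMean (s n)) g (ph n) (dph n) w a)
      (fun w => scoreInfluence E g p dp w a) := by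
    intro a
    exact WeightedUnif.sum Finset.univ (by simp) fun b _ => (hscore b).const_mul
      (tendsto_pi_nhds.1 (tendsto_pi_nhds.1 hinv a) b)
  have hM : ∀ a : Fin k, Tendsto (fun n => Mvec (sampleMean (s n)) g t (ph n) (dph n) a) atTop
      (𝓝 (Mvec E g t p dp a)) := by
    intro a
    have hcq := weightedUnif_ctrl.bdd_mul hq
    have h := (((hX a).bdd_mul (hcq.bdd_mul hcq)).bdd_mul hdp).bdd_mul hDm
    simp only [← div_eq_mul_inv, ← sq] at h
    exact (h.tendsto_sampleMean hs lH (lM a)).div modds hC0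
  have hMξ : WeightedUnif S (fun _ => 1)
      (fun n w => Mvec (sampleMean (s n)) g t (ph n) (dph n)
        ⬝ᵥ scoreInfluence (sampleMean (s n)) g (ph n) (dph n) w)
      (fun w => Mvec E g t p dp ⬝ᵥ scoreInfluence E g p dp w) :=
    WeightedUnif.sum Finset.univ (by simp) fun a _ => (hξ a).const_mul (hM a)
  exact hψG.sub ((hwC.bdd_mul hDm).add (toH hMξ))

end Path

/-- A function of the index at a convergent sequence of parameters converges uniformly. -/
lemma weightedUnif_comp_inner {μ : Measure (Obs T k)} {Par : Set (EuclideanSpace ℝ (Fin k))}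
    (hX : IsCompact (suppX μ)) (hK : IsCompact (indexSet μ Par)) {ψ : ℝ → ℝ}
    (hψ : ContinuousOn ψ (indexSet μ Par)) {π : ℕ → EuclideanSpace ℝ (Fin k)}
    {π₀ : EuclideanSpace ℝ (Fin k)} (hπ : ∀ n, π n ∈ Par) (hπ₀ : π₀ ∈ Par)
    (hlim : Tendsto π atTop (𝓝 π₀)) :
    WeightedUnif {w : Obs T k | covariate w ∈ suppX μ} (fun _ => 1)
      (fun n w => ψ (inner ℝ (covariate w) (π n))) fun w => ψ (inner ℝ (covariate w) π₀) := by
  obtain ⟨c, hc⟩ := hK.exists_bound_of_continuousOn hψ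
  obtain ⟨R, hR⟩ := hX.isBounded.exists_norm_le
  refine ⟨fun δ hδ => ?_, max c 0, le_max_right _ _, fun w hw => ?_⟩
  -- `ψ` is uniformly continuous on the compact index set, and Cauchy–Schwarz with bounded support
  -- makes `X'π_n → X'π₀` uniform in `X`.
  · obtain ⟨η, hη, hu⟩ := Metric.uniformContinuousOn_iff.1
      (hK.uniformContinuousOn_of_continuous hψ) δ hδ
    have hR1 : 0 < |R| + 1 := by positivity
    filter_upwards [(Metric.tendsto_nhds.1 hlim) (η / (|R| + 1)) (by positivity)] with n hn w hw
    have h := hu _ (inner_mem_indexSet hw (hπ n)) _ (inner_mem_indexSet hw hπ₀) ?_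
    · rw [mul_one]
      exact (Real.dist_eq _ _ ▸ h).le
    · rw [Real.dist_eq, ← inner_sub_right]
      rw [dist_eq_norm] at hn
      calc |inner ℝ (covariate w) (π n - π₀)| ≤ ‖covariate w‖ * ‖π n - π₀‖ :=
            abs_real_inner_le_norm _ _
        _ ≤ (|R| + 1) * ‖π n - π₀‖ := by
            gcongr
            exact (hR _ hw).trans ((le_abs_self R).trans (by linarith))
        _ < (|R| + 1) * (η / (|R| + 1)) := by gcongr
        _ = η := by field_simp
  · rw [mul_one]
    exact (hc _ (inner_mem_indexSet hw hπ₀)).trans (le_max_left _ _)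


/-! ### Replacing the propensity score by its parametric version -/

section Congr

variable {μ : Measure (Obs T k)} {g : Period T} {p p' : Obs T k → ℝ}

/-- The influence functions depend on the propensity score only through its values on the
subpopulation `G_g + C = 1`. -/
lemma psi_congr (h : ∀ᵐ w ∂μ, w ∈ groupOrControl g → p w = p' w) (t : Period T)
    (dp : Obs T k → ℝ) :
    (fun w => psiG (fun f => ∫ v, f v ∂μ) g t w - psiC (fun f => ∫ v, f v ∂μ) g t p dp w)
      =ᵐ[μ] fun w => psiG (fun f => ∫ v, f v ∂μ) g t w
        - psiC (fun f => ∫ v, f v ∂μ) g t p' dp w := by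
  -- Outside the subpopulation both indicators vanish, and every occurrence of `p` carries one of
  -- them, or their sum, as a factor.
  have hcase : ∀ᵐ w ∂μ, p w = p' w ∨ (grp g w = 0 ∧ ctrl w = 0) := by
    filter_upwards [h] with w hw
    rcases grp_ctrl_cases g w with hc | hc | hc
    · exact Or.inl (hw (by simp [groupOrControl, hc]))
    · exact Or.inl (hw (by simp [groupOrControl, hc]))
    · exact Or.inr hc
  have hodds : oddsWeight p =ᵐ[μ] oddsWeight p' := by
    filter_upwards [hcase] with w hw
    rcases hw with hw | hw <;> simp [oddsWeight, hw]
  have hEo : ∫ v, oddsWeight p v ∂μ = ∫ v, oddsWeight p' v ∂μ := integral_congr_ae hodds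
  have hwC : weightC (fun f => ∫ v, f v ∂μ) p =ᵐ[μ] weightC (fun f => ∫ v, f v ∂μ) p' := by
    filter_upwards [hodds] with w hw
    simp only [weightC, hw, hEo]
  have hm : ∫ v, weightC (fun f => ∫ v, f v ∂μ) p v * longDiff g t v ∂μ
      = ∫ v, weightC (fun f => ∫ v, f v ∂μ) p' v * longDiff g t v ∂μ := by
    refine integral_congr_ae ?_
    filter_upwards [hwC] with w hw
    rw [hw]
  have hI : infoMatrix (fun f => ∫ v, f v ∂μ) g p dp
      = infoMatrix (fun f => ∫ v, f v ∂μ) g p' dp := by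
    ext a b
    refine integral_congr_ae ?_
    filter_upwards [hcase] with w hw
    rcases hw with hw | hw <;> simp [hw]
  have hM : Mvec (fun f => ∫ v, f v ∂μ) g t p dp = Mvec (fun f => ∫ v, f v ∂μ) g t p' dp := by
    ext a
    simp only [Mvec, hm, hEo]
    congr 1
    refine integral_congr_ae ?_
    filter_upwards [hcase] with w hw
    rcases hw with hw | hw <;> simp [hw]
  filter_upwards [hcase, hwC] with w hw hw2
  have hξ : scoreInfluence (fun f => ∫ v, f v ∂μ) g p dp w
      = scoreInfluence (fun f => ∫ v, f v ∂μ) g p' dp w := by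
    simp only [scoreInfluence, hI]
    congr 1
    ext a
    rcases hw with hw | hw <;> simp [hw]
  simp only [psiC, hw2, hm, hM, hξ]

end Congr

/-! ### The envelope and the population moments -/

/-- The envelope `1 + ∑_t |Y_t|`. -/
noncomputable def envelope (w : Obs T k) : ℝ := 1 + ∑ t : Period T, |outcome t w|

lemma one_le_envelope (w : Obs T k) : 1 ≤ envelope w := by
  have : 0 ≤ ∑ t : Period T, |outcome t w| := Finset.sum_nonneg fun t _ => abs_nonneg _
  unfold envelope
  linarith

lemma abs_longDiff_le (g t : Period T) (w : Obs T k) : |longDiff g t w| ≤ 2 * envelope w := by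
  have h : ∀ t : Period T, |outcome t w| ≤ envelope w := fun t => by
    have := Finset.single_le_sum (f := fun t : Period T => |outcome t w|)
      (fun t _ => abs_nonneg _) (Finset.mem_univ t)
    unfold envelope
    linarith
  have := abs_sub (outcome t w) (outcome g.before w)
  unfold longDiff
  linarith [h t, h g.before]

section Moments

variable {μ : Measure (Obs T k)}

lemma memLp_envelope [IsFiniteMeasure μ] (hY : SquareIntegrableOutcomes μ) :
    MemLp envelope 2 μ := by
  have h1 : MemLp (fun w : Obs T k => ∑ t : Period T, |outcome t w|) 2 μ :=
    memLp_finsetSum _ fun t _ => (hY t).norm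
  have h2 : MemLp (fun _ : Obs T k => (1 : ℝ)) 2 μ := memLp_const 1
  exact h2.add h1

lemma WeightedUnif.integrable {H h : Obs T k → ℝ} {f : ℕ → Obs T k → ℝ}
    (hf : WeightedUnif {w | covariate w ∈ suppX μ} H f h) (hm : AEMeasurable h μ)
    (hH : Integrable H μ) : Integrable h μ := by
  obtain ⟨B, hB, hb⟩ := hf.bound
  refine (hH.const_mul B).mono' hm.aestronglyMeasurable ?_
  filter_upwards [covariate_mem_suppX (μ := μ)] with w hw
  exact hb w hw

lemma WeightedUnif.memLp {H h : Obs T k → ℝ} {f : ℕ → Obs T k → ℝ}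
    (hf : WeightedUnif {w | covariate w ∈ suppX μ} H f h) (hm : AEMeasurable h μ)
    (hH : MemLp H 2 μ) : MemLp h 2 μ := by
  obtain ⟨B, hB, hb⟩ := hf.bound
  refine (hH.const_mul B).mono hm.aestronglyMeasurable ?_
  filter_upwards [covariate_mem_suppX (μ := μ)] with w hw
  exact (hb w hw).trans (le_abs_self _)

lemma aemeasurable_comp_inner {Par : Set (EuclideanSpace ℝ (Fin k))} {ψ : ℝ → ℝ}
    (hψ : ContinuousOn ψ (indexSet μ Par)) {π : EuclideanSpace ℝ (Fin k)} (hπ : π ∈ Par) :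
    AEMeasurable (fun w : Obs T k => ψ (inner ℝ (covariate w) π)) μ := by
  refine ⟨_, (measurable_onSupp hψ hπ).comp measurable_covariate, ?_⟩
  filter_upwards [covariate_mem_suppX (μ := μ)] with w hw
  simp only [Function.comp, onSupp]
  rw [Set.indicator_of_mem hw]

variable [IsProbabilityMeasure μ] {g : Period T}

lemma integral_grp_pos (hg : 0 < μ {w | grp g w = 1}) : 0 < ∫ w, grp g w ∂μ := by
  have hn : ∀ w : Obs T k, 0 ≤ grp g w := fun w => by
    rcases grp_ctrl_cases g w with h | h | h <;> simp [h]
  rw [integral_pos_iff_support_of_nonneg hn (Integrable.of_bound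
    (measurable_grp g).aestronglyMeasurable 1 (Eventually.of_forall (abs_grp_le g)))]
  refine hg.trans_le (measure_mono fun w hw => ?_)
  have : grp g w = 1 := hw
  simp [this]

variable {Λ : ℝ → ℝ} {Par : Set (EuclideanSpace ℝ (Fin k))} {π₀ : EuclideanSpace ℝ (Fin k)}

/-- Without controls, `E[G] = E[(G + C) p_g(X)] ≤ (1 - ε) E[G + C] = (1 - ε) E[G]`, which
contradicts `E[G] > 0`. -/
lemma PropensityModel.integral_ctrl_pos (hm : PropensityModel μ g Λ Par π₀)
    (hg : 0 < μ {w | grp g w = 1}) : 0 < ∫ w, ctrl w ∂μ := by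
  have hC : ∀ w : Obs T k, 0 ≤ ctrl w := fun w => by
    rcases ctrl_eq_zero_or_one w with h | h <;> simp [h]
  refine (integral_nonneg hC).lt_of_ne fun h0 => ?_
  have iG : Integrable (grp g) μ := Integrable.of_bound
    (measurable_grp g).aestronglyMeasurable 1 (Eventually.of_forall (abs_grp_le g))
  have iC : Integrable ctrl μ := Integrable.of_bound
    measurable_ctrl.aestronglyMeasurable 1 (Eventually.of_forall abs_ctrl_le)
  obtain ⟨ε, hε, hin⟩ := hm.away_from_zero_one
  have hps := (ae_cond_iff (measurableSet_groupOrControl g) (measure_ne_top μ _)).1 hm.model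
  have h1 := integral_grp_mul hg (h := fun _ => (1 : ℝ)) measurable_const (c := 1) (by simp)
  simp only [mul_one] at h1
  have hb : ∀ᵐ w ∂μ, (grp g w + ctrl w) * pscore μ g w ≤ (1 - ε) * (grp g w + ctrl w) := by
    filter_upwards [hps, covariate_mem_suppX (μ := μ)] with w hw hx
    by_cases hgc : w ∈ groupOrControl g
    · rw [hw hgc, mul_comm]
      refine mul_le_mul_of_nonneg_right
        (hin _ (inner_mem_indexSet hx hm.true_mem_par)).2 ?_
      rw [show grp g w + ctrl w = 1 from hgc]
      exact zero_le_one
    · have : grp g w + ctrl w = 0 := by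
        rw [grp_add_ctrl_eq_indicator]; simp [hgc]
      simp [this]
  have hle : ∫ w, (grp g w + ctrl w) * pscore μ g w ∂μ
      ≤ ∫ w, (1 - ε) * (grp g w + ctrl w) ∂μ := by
    refine integral_mono_of_nonneg ?_ ((iG.add iC).const_mul _) hb
    filter_upwards [hps] with w hw
    by_cases hgc : w ∈ groupOrControl g
    · rw [hw hgc, show grp g w + ctrl w = 1 from hgc, one_mul]
      exact (hm.range_mem _).1
    · have : grp g w + ctrl w = 0 := by
        rw [grp_add_ctrl_eq_indicator]; simp [hgc]
      simp [this]
  rw [← h1, integral_const_mul, integral_add iG iC, ← h0, add_zero] at hle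
  nlinarith [integral_grp_pos hg]

end Moments

lemma weightedUnif_longDiff (g t : Period T) {S : Set (Obs T k)} :
    WeightedUnif S envelope (fun _ => longDiff g t) (longDiff g t) :=
  .of_fixed zero_le_two (fun w _ => zero_le_one.trans (one_le_envelope w))
    fun w _ => abs_longDiff_le g t w

lemma weightedUnif_covariate {μ : Measure (Obs T k)} (hS : IsCompact (suppX μ)) (a : Fin k) :
    WeightedUnif {w : Obs T k | covariate w ∈ suppX μ} (fun _ => 1) (fun _ w => covariate w a)
      fun w => covariate w a := by
  obtain ⟨R, hR⟩ := hS.isBounded.exists_norm_le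
  refine .of_fixed (B := max R 0) (le_max_right _ _) (by simp) fun w hw => ?_
  rw [mul_one]
  exact (PiLp.norm_apply_le (covariate w) a).trans ((hR _ hw).trans (le_max_left _ _))

/-! ### Measurability and integrability of the population integrands. -/

section Integrands

variable {μ : Measure (Obs T k)} {E : (Obs T k → ℝ) → ℝ} {g : Period T} {p dp : Obs T k → ℝ}

lemma aemeasurable_covariate_apply (a : Fin k) :
    AEMeasurable (fun w : Obs T k => covariate w a) μ := by
  have hX := measurable_covariate (T := T) (k := k)
  fun_prop

lemma aemeasurable_weightG : AEMeasurable (weightG E g) μ :=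
  (measurable_grp g).aemeasurable.div_const _

lemma aemeasurable_oddsWeight (hp : AEMeasurable p μ) : AEMeasurable (oddsWeight p) μ :=
  (hp.mul measurable_ctrl.aemeasurable).div (hp.const_sub 1)

lemma aemeasurable_weightC (hp : AEMeasurable p μ) : AEMeasurable (weightC E p) μ :=
  (aemeasurable_oddsWeight hp).div_const _

lemma aemeasurable_scoreInfluence (hp : AEMeasurable p μ) (hd : AEMeasurable dp μ) (a : Fin k) :
    AEMeasurable (fun w => scoreInfluence E g p dp w a) μ := by
  have hG : AEMeasurable (grp g) μ := (measurable_grp g).aemeasurable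
  have hC : AEMeasurable ctrl μ := measurable_ctrl.aemeasurable
  simp only [scoreInfluence, Matrix.mulVec, dotProduct]
  refine Finset.aemeasurable_fun_sum _ fun b _ => AEMeasurable.const_mul ?_ _
  exact (aemeasurable_covariate_apply b).mul
    ((((hG.add hC).mul (hG.sub hp)).mul hd).div (hp.mul (hp.const_sub 1)))

lemma aemeasurable_psi (hp : AEMeasurable p μ) (hd : AEMeasurable dp μ) (t : Period T) :
    AEMeasurable (fun w => psiG E g t w - psiC E g t p dp w) μ := by
  have hD : AEMeasurable (longDiff g t) μ := (measurable_longDiff g t).aemeasurable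
  refine (aemeasurable_weightG.mul (hD.sub_const _)).sub
    (((aemeasurable_weightC hp).mul (hD.sub_const _)).add ?_)
  exact Finset.aemeasurable_fun_sum _ fun a _ =>
    (aemeasurable_scoreInfluence hp hd a).const_mul _

variable [IsFiniteMeasure μ]

lemma integrable_grp : Integrable (grp g) μ :=
  (weightedUnif_grp (g := g)).integrable (measurable_grp g).aemeasurable (integrable_const 1)

lemma integrable_weightG_mul_longDiff (hY : SquareIntegrableOutcomes μ) (t : Period T) :
    Integrable (fun w => weightG E g w * longDiff g t w) μ := by
  have uwG := (weightedUnif_grp (S := {w : Obs T k | covariate w ∈ suppX μ}) (g := g)).bdd_mul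
    (.of_tendsto (tendsto_const_nhds (x := (E (grp g))⁻¹)))
  simp only [← div_eq_mul_inv] at uwG
  exact (uwG.bdd_mul (weightedUnif_longDiff g t)).integrable
    (aemeasurable_weightG.mul (measurable_longDiff g t).aemeasurable)
    ((memLp_envelope hY).integrable one_le_two)

variable (hp : WeightedUnif {w | covariate w ∈ suppX μ} (fun _ => 1) (fun _ => p) p)
  (hq : WeightedUnif {w | covariate w ∈ suppX μ} (fun _ => 1) (fun _ w => (1 - p w)⁻¹)
    fun w => (1 - p w)⁻¹) (hpm : AEMeasurable p μ)

include hp hq hpm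

lemma integrable_oddsWeight : Integrable (oddsWeight p) μ :=
  (weightedUnif_oddsWeight hp hq).integrable (aemeasurable_oddsWeight hpm) (integrable_const 1)

lemma integrable_weightC_mul_longDiff (hY : SquareIntegrableOutcomes μ) (t : Period T) :
    Integrable (fun w => weightC E p w * longDiff g t w) μ := by
  have uwC := (weightedUnif_oddsWeight hp hq).bdd_mul
    (.of_tendsto (tendsto_const_nhds (x := (E (oddsWeight p))⁻¹)))
  simp only [← div_eq_mul_inv] at uwC
  exact (uwC.bdd_mul (weightedUnif_longDiff g t)).integrable
    ((aemeasurable_weightC hpm).mul (measurable_longDiff g t).aemeasurable)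
    ((memLp_envelope hY).integrable one_le_two)

omit hp in
lemma integrable_Mvec_integrand (hS : IsCompact (suppX μ))
    (hd : WeightedUnif {w | covariate w ∈ suppX μ} (fun _ => 1) (fun _ => dp) dp)
    (hdm : AEMeasurable dp μ) (hY : SquareIntegrableOutcomes μ) (t : Period T) (c : ℝ)
    (a : Fin k) :
    Integrable (fun w => covariate w a * (ctrl w / (1 - p w)) ^ 2 * dp w *
      (longDiff g t w - c)) μ := by
  have ucq := weightedUnif_ctrl.bdd_mul hq
  have uM := (((weightedUnif_covariate hS a).bdd_mul (ucq.bdd_mul ucq)).bdd_mul hd).bdd_mul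
    ((weightedUnif_longDiff g t).sub ((WeightedUnif.of_tendsto (tendsto_const_nhds
      (x := c))).mono fun w _ => one_le_envelope w))
  simp only [← div_eq_mul_inv, ← sq] at uM
  refine uM.integrable ?_ ((memLp_envelope hY).integrable one_le_two)
  exact (((aemeasurable_covariate_apply a).mul ((measurable_ctrl.aemeasurable.div
    (hpm.const_sub 1)).pow_const 2)).mul hdm).mul
    ((measurable_longDiff g t).aemeasurable.sub_const _)

omit hp hq in
lemma integrable_info_integrand (hS : IsCompact (suppX μ))
    (hpq : WeightedUnif {w | covariate w ∈ suppX μ} (fun _ => 1)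
      (fun _ w => (p w * (1 - p w))⁻¹) fun w => (p w * (1 - p w))⁻¹)
    (hd : WeightedUnif {w | covariate w ∈ suppX μ} (fun _ => 1) (fun _ => dp) dp)
    (hdm : AEMeasurable dp μ) (a b : Fin k) :
    Integrable (fun w => (grp g w + ctrl w) * dp w ^ 2 / (p w * (1 - p w)) *
      (covariate w a * covariate w b)) μ := by
  have h := (((weightedUnif_grp (g := g)).add weightedUnif_ctrl).bdd_mul
    (hd.bdd_mul hd) |>.bdd_mul hpq).bdd_mul
    ((weightedUnif_covariate hS a).bdd_mul (weightedUnif_covariate hS b))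
  simp only [← div_eq_mul_inv, ← sq] at h
  refine h.integrable ?_ (integrable_const 1)
  exact ((((measurable_grp g).add measurable_ctrl).aemeasurable.mul (hdm.pow_const 2)).div
    (hpm.mul (hpm.const_sub 1))).mul
    ((aemeasurable_covariate_apply a).mul (aemeasurable_covariate_apply b))

end Integrands

/-! ### Nondegenerate denominators and almost sure uniform convergence for one group. -/

section FixedGroup

variable {μ : Measure (Obs T k)} {g : Period T} {Λ : ℝ → ℝ}
  {Par : Set (EuclideanSpace ℝ (Fin k))} {π₀ : EuclideanSpace ℝ (Fin k)}

lemma PropensityModel.continuousOn_inv_one_sub (hm : PropensityModel μ g Λ Par π₀) :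
    ContinuousOn (fun u => (1 - Λ u)⁻¹) (indexSet μ Par) :=
  (continuousOn_const.sub hm.continuousOn).inv₀ fun _ hu => (sub_pos.2 (hm.mem_Ioo hu).2).ne'

lemma PropensityModel.continuousOn_inv_mul (hm : PropensityModel μ g Λ Par π₀) :
    ContinuousOn (fun u => (Λ u * (1 - Λ u))⁻¹) (indexSet μ Par) :=
  (hm.continuousOn.mul (continuousOn_const.sub hm.continuousOn)).inv₀ fun _ hu =>
    (mul_pos (hm.mem_Ioo hu).1 (sub_pos.2 (hm.mem_Ioo hu).2)).ne'

lemma PropensityModel.weightedUnif (hm : PropensityModel μ g Λ Par π₀) {ψ : ℝ → ℝ}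
    (hψ : ContinuousOn ψ (indexSet μ Par)) :
    WeightedUnif {w : Obs T k | covariate w ∈ suppX μ} (fun _ => 1)
      (fun _ w => ψ (inner ℝ (covariate w) π₀)) fun w => ψ (inner ℝ (covariate w) π₀) :=
  weightedUnif_comp_inner hm.isCompact_suppX hm.isCompact_indexSet hψ
    (fun _ => hm.true_mem_par) hm.true_mem_par tendsto_const_nhds

lemma PropensityModel.aemeasurable_comp (hm : PropensityModel μ g Λ Par π₀) {ψ : ℝ → ℝ}
    (hψ : ContinuousOn ψ (indexSet μ Par)) :
    AEMeasurable (fun w : Obs T k => ψ (inner ℝ (covariate w) π₀)) μ :=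
  aemeasurable_comp_inner hψ hm.true_mem_par

variable [IsProbabilityMeasure μ]

/-- On the support `p / (1 - p) ≥ p ≥ ε`, so the expected odds weight is at least `ε E[C]`. -/
lemma PropensityModel.integral_oddsWeight_pos (hm : PropensityModel μ g Λ Par π₀)
    (hg : 0 < μ {w | grp g w = 1}) :
    0 < ∫ w, oddsWeight (fun w => Λ (inner ℝ (covariate w) π₀)) w ∂μ := by
  obtain ⟨ε, hε, hin⟩ := hm.away_from_zero_one
  have hint := integrable_oddsWeight (hm.weightedUnif hm.continuousOn)
    (hm.weightedUnif hm.continuousOn_inv_one_sub) (hm.aemeasurable_comp hm.continuousOn)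
  have hle : ∫ w, ε * ctrl w ∂μ ≤ ∫ w, oddsWeight (fun w => Λ (inner ℝ (covariate w) π₀)) w ∂μ := by
    refine integral_mono_ae ((Integrable.of_bound
      measurable_ctrl.aestronglyMeasurable 1 (Eventually.of_forall abs_ctrl_le)).const_mul ε)
      hint ?_
    filter_upwards [covariate_mem_suppX (μ := μ)] with w hw
    have hI := inner_mem_indexSet hw hm.true_mem_par
    have h1 := hin _ hI
    have h2 := hm.mem_Ioo hI
    rcases ctrl_eq_zero_or_one w with h | h
    · simp [oddsWeight, h]
    · simp only [oddsWeight, h, mul_one]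
      rw [le_div_iff₀ (sub_pos.2 h2.2)]
      nlinarith [h1.1, h1.2, h2.1, h2.2]
  rw [integral_const_mul] at hle
  exact (mul_pos hε (hm.integral_ctrl_pos hg)).trans_le hle

lemma PropensityModel.integrable_info (hm : PropensityModel μ g Λ Par π₀) (a b : Fin k) :
    Integrable (fun w => (grp g w + ctrl w) * deriv Λ (inner ℝ (covariate w) π₀) ^ 2 /
      (Λ (inner ℝ (covariate w) π₀) * (1 - Λ (inner ℝ (covariate w) π₀))) *
        (covariate w a * covariate w b)) μ :=
  integrable_info_integrand (hm.aemeasurable_comp hm.continuousOn) hm.isCompact_suppX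
    (hm.weightedUnif hm.continuousOn_inv_mul) (hm.weightedUnif hm.continuousOn_deriv)
    (hm.aemeasurable_comp hm.continuousOn_deriv) a b

/-- A null vector `v` would make `E[(G + C) ṗ² / (p (1 - p)) (X'v)²]` vanish. The weight is positive
on the subpopulation because `Λ'` is bounded away from zero, so `X'v = 0` there almost surely,
against positive definiteness of the second moments. -/
lemma PropensityModel.det_infoMatrix_ne_zero (hm : PropensityModel μ g Λ Par π₀)
    (hg : 0 < μ {w | grp g w = 1}) :
    (infoMatrix (fun f => ∫ w, f w ∂μ) g (fun w => Λ (inner ℝ (covariate w) π₀))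
      (fun w => deriv Λ (inner ℝ (covariate w) π₀))).det ≠ 0 := by
  intro hdet
  obtain ⟨v, hv, hIv⟩ := Matrix.exists_mulVec_eq_zero_iff.2 hdet
  have hquad := dotProduct_mulVec_integral hm.integrable_info v
  have e : ∀ w : Obs T k, ∑ a, ∑ b, v a * v b *
      ((grp g w + ctrl w) * deriv Λ (inner ℝ (covariate w) π₀) ^ 2 /
      (Λ (inner ℝ (covariate w) π₀) * (1 - Λ (inner ℝ (covariate w) π₀))) *
        (covariate w a * covariate w b))
      = (grp g w + ctrl w) * deriv Λ (inner ℝ (covariate w) π₀) ^ 2 /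
      (Λ (inner ℝ (covariate w) π₀) * (1 - Λ (inner ℝ (covariate w) π₀))) *
        (inner ℝ (covariate w) (WithLp.toLp 2 v)) ^ 2 := by
    intro w
    have hin : inner ℝ (covariate w) (WithLp.toLp 2 v) = ∑ a, v a * covariate w a := by
      simp [PiLp.inner_apply]
    rw [hin, sq (∑ a, _), Finset.sum_mul_sum, Finset.mul_sum]
    refine Finset.sum_congr rfl fun a _ => ?_
    rw [Finset.mul_sum]
    refine Finset.sum_congr rfl fun b _ => ?_
    ring
  have hint : Integrable (fun w : Obs T k => ∑ a, ∑ b, v a * v b *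
      ((grp g w + ctrl w) * deriv Λ (inner ℝ (covariate w) π₀) ^ 2 /
      (Λ (inner ℝ (covariate w) π₀) * (1 - Λ (inner ℝ (covariate w) π₀))) *
        (covariate w a * covariate w b))) μ :=
    integrable_finsetSum _ fun a _ => integrable_finsetSum _ fun b _ =>
      (hm.integrable_info a b).const_mul _
  have hz : ∫ w, ∑ a, ∑ b, v a * v b *
      ((grp g w + ctrl w) * deriv Λ (inner ℝ (covariate w) π₀) ^ 2 /
      (Λ (inner ℝ (covariate w) π₀) * (1 - Λ (inner ℝ (covariate w) π₀))) *
        (covariate w a * covariate w b)) ∂μ = 0 := by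
    rw [← hquad]
    change v ⬝ᵥ (infoMatrix (fun f => ∫ w, f w ∂μ) g (fun w => Λ (inner ℝ (covariate w) π₀))
      (fun w => deriv Λ (inner ℝ (covariate w) π₀))) *ᵥ v = 0
    rw [hIv, dotProduct_zero]
  simp_rw [e] at hint hz
  rw [integral_eq_zero_iff_of_nonneg_ae ?_ hint] at hz
  · obtain ⟨c, B, hc, hder⟩ := hm.deriv_bounds
    -- The condition `X'v = 0` is rephrased as equality of the indices at `v + π₀` and `π₀`, to
    -- reuse identification.
    have h : WithLp.toLp 2 v + π₀ = π₀ := by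
      refine hm.eq_of_inner_eq hg ?_
      filter_upwards [hz, covariate_mem_suppX (μ := μ)] with w hw hx hgc
      have hI := inner_mem_indexSet hx hm.true_mem_par
      have h1 := hm.mem_Ioo hI
      have h2 := (hder _ hI).1
      rw [show grp g w + ctrl w = 1 from hgc] at hw
      have hne : 1 * deriv Λ (inner ℝ (covariate w) π₀) ^ 2 /
          (Λ (inner ℝ (covariate w) π₀) * (1 - Λ (inner ℝ (covariate w) π₀))) ≠ 0 := by
        have : 0 < deriv Λ (inner ℝ (covariate w) π₀) := hc.trans_le h2
        have := mul_pos h1.1 (sub_pos.2 h1.2)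
        positivity
      have h3 := (mul_eq_zero.1 hw).resolve_left hne
      rw [inner_add_right, pow_eq_zero_iff two_ne_zero |>.1 h3, zero_add]
    apply hv
    have := add_eq_right.1 h
    simpa using congrArg WithLp.ofLp this
  · filter_upwards [covariate_mem_suppX (μ := μ)] with w hx
    have h1 := hm.mem_Ioo (inner_mem_indexSet hx hm.true_mem_par)
    have h2 : 0 ≤ grp g w + ctrl w := by
      rcases grp_ctrl_cases g w with h | h | h <;> simp [h]
    have := mul_pos h1.1 (sub_pos.2 h1.2)
    change (0 : ℝ) ≤ _
    positivity

/-- Almost surely, the influence function of `ATT(g,t)` with estimated nuisance functions converges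
uniformly relative to the envelope if the nuisance functions converge uniformly. -/
lemma ae_weightedUnif_psi {p dp : Obs T k → ℝ} (hS : IsCompact (suppX μ))
    (up : WeightedUnif {w | covariate w ∈ suppX μ} (fun _ => 1) (fun _ => p) p)
    (ud : WeightedUnif {w | covariate w ∈ suppX μ} (fun _ => 1) (fun _ => dp) dp)
    (uq : WeightedUnif {w | covariate w ∈ suppX μ} (fun _ => 1) (fun _ w => (1 - p w)⁻¹)
      fun w => (1 - p w)⁻¹)
    (upq : WeightedUnif {w | covariate w ∈ suppX μ} (fun _ => 1)
      (fun _ w => (p w * (1 - p w))⁻¹) fun w => (p w * (1 - p w))⁻¹)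
    (mp : AEMeasurable p μ) (md : AEMeasurable dp μ)
    (hG0 : ∫ w, grp g w ∂μ ≠ 0) (hC0 : ∫ w, oddsWeight p w ∂μ ≠ 0)
    (hI0 : (infoMatrix (fun f => ∫ w, f w ∂μ) g p dp).det ≠ 0)
    (hY : SquareIntegrableOutcomes μ) (t : Period T)
    {Ω : Type*} [MeasurableSpace Ω] {P : Measure Ω}
    {W : ℕ → Ω → Obs T k} (hWm : ∀ i, Measurable (W i)) (hWind : iIndepFun W P)
    (hWlaw : ∀ i, P.map (W i) = μ) {ph dph : Ω → ℕ → Obs T k → ℝ}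
    (hph : ∀ᵐ ω ∂P, WeightedUnif {w | covariate w ∈ suppX μ} (fun _ => 1) (ph ω) p)
    (hdph : ∀ᵐ ω ∂P, WeightedUnif {w | covariate w ∈ suppX μ} (fun _ => 1) (dph ω) dp)
    (hqh : ∀ᵐ ω ∂P, WeightedUnif {w | covariate w ∈ suppX μ} (fun _ => 1)
      (fun n w => (1 - ph ω n w)⁻¹) fun w => (1 - p w)⁻¹)
    (hpqh : ∀ᵐ ω ∂P, WeightedUnif {w | covariate w ∈ suppX μ} (fun _ => 1)
      (fun n w => (ph ω n w * (1 - ph ω n w))⁻¹) fun w => (p w * (1 - p w))⁻¹) :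
    ∀ᵐ ω ∂P, WeightedUnif {w : Obs T k | covariate w ∈ suppX μ} envelope
      (fun n w => psiG (sampleMean (firstN W n ω)) g t w
        - psiC (sampleMean (firstN W n ω)) g t (ph ω n) (dph ω n) w)
      (fun w => psiG (fun f => ∫ w, f w ∂μ) g t w
        - psiC (fun f => ∫ w, f w ∂μ) g t p dp w) := by
  have hcov : ∀ᵐ ω ∂P, ∀ i, covariate (W i ω) ∈ suppX μ := by
    rw [ae_all_iff]
    intro i
    exact ae_of_ae_map (hWm i).aemeasurable (by rw [hWlaw i]; exact covariate_mem_suppX)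
  have lln := fun {f : Obs T k → ℝ} (hf : Integrable f μ) => tendsto_sampleMean hWm hWind hWlaw hf
  filter_upwards [hcov, hph, hdph, hqh, hpqh, lln ((memLp_envelope hY).integrable one_le_two),
    lln (integrable_grp (g := g)), lln (integrable_weightG_mul_longDiff hY t),
    lln (integrable_oddsWeight up uq mp), lln (integrable_weightC_mul_longDiff up uq mp hY t),
    ae_all_iff.2 fun a => ae_all_iff.2 fun b =>
      lln (integrable_info_integrand (g := g) mp hS upq ud md a b),
    -- The hole is the population centring constant `E[w_g^C (Y_t - Y_{g-1})]`; its estimated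
    -- counterpart is handled by the uniform convergence argument.
    ae_all_iff.2 fun a => lln (integrable_Mvec_integrand uq mp hS ud md hY t _ a)]
    with ω hcov hph hdph hqh hpqh lH lG lGD lO lCD lI lM
  exact weightedUnif_psi (fun n i => hcov i) (fun w _ => one_le_envelope w)
    (weightedUnif_longDiff g t) (fun a => weightedUnif_covariate hS a) hph hdph hqh hpqh
    hG0 hC0 hI0 lH lG lGD lO lCD lI lM

/-- Consistency of the estimator makes every continuous function of the fitted index converge
uniformly. Four are needed: `Λ`, `Λ'`, `(1 - Λ)⁻¹` and `(Λ (1 - Λ))⁻¹`; the inverses are continuous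
because `Λ` stays strictly between 0 and 1 on the index set. -/
lemma PropensityModel.ae_weightedUnif_psi (hm : PropensityModel μ g Λ Par π₀)
    (hg : 0 < μ {w | grp g w = 1}) (hY : SquareIntegrableOutcomes μ) (t : Period T)
    {Ω : Type*} [MeasurableSpace Ω] {P : Measure Ω}
    {W : ℕ → Ω → Obs T k} (hWm : ∀ i, Measurable (W i)) (hWind : iIndepFun W P)
    (hWlaw : ∀ i, P.map (W i) = μ) {πhat : ℕ → Ω → EuclideanSpace ℝ (Fin k)}
    (hπ : ∀ n, ∀ᵐ ω ∂P, IsMLE (firstN W n ω) g Λ Par (πhat n ω)) :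
    ∀ᵐ ω ∂P, WeightedUnif {w : Obs T k | covariate w ∈ suppX μ} envelope
      (fun n w => psiG (sampleMean (firstN W n ω)) g t w
        - psiC (sampleMean (firstN W n ω)) g t (fun w => Λ (inner ℝ (covariate w) (πhat n ω)))
          (fun w => deriv Λ (inner ℝ (covariate w) (πhat n ω))) w)
      (fun w => psiG (fun f => ∫ w, f w ∂μ) g t w
        - psiC (fun f => ∫ w, f w ∂μ) g t (fun w => Λ (inner ℝ (covariate w) π₀))
          (fun w => deriv Λ (inner ℝ (covariate w) π₀)) w) := by
  have hconv : ∀ {ψ : ℝ → ℝ}, ContinuousOn ψ (indexSet μ Par) → ∀ᵐ ω ∂P,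
      WeightedUnif {w : Obs T k | covariate w ∈ suppX μ} (fun _ => 1)
        (fun n w => ψ (inner ℝ (covariate w) (πhat n ω)))
        fun w => ψ (inner ℝ (covariate w) π₀) := by
    intro ψ hψ
    filter_upwards [hm.tendsto_mle hg hWm hWind hWlaw hπ, ae_all_iff.2 hπ] with ω hlim hmle
    exact weightedUnif_comp_inner hm.isCompact_suppX hm.isCompact_indexSet hψ
      (fun n => (hmle n).1) hm.true_mem_par hlim
  exact DID.ae_weightedUnif_psi hm.isCompact_suppX (hm.weightedUnif hm.continuousOn)
    (hm.weightedUnif hm.continuousOn_deriv) (hm.weightedUnif hm.continuousOn_inv_one_sub)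
    (hm.weightedUnif hm.continuousOn_inv_mul) (hm.aemeasurable_comp hm.continuousOn)
    (hm.aemeasurable_comp hm.continuousOn_deriv) (integral_grp_pos hg).ne'
    (hm.integral_oddsWeight_pos hg).ne' (hm.det_infoMatrix_ne_zero hg) hY t hWm hWind hWlaw
    (ph := fun ω n w => Λ (inner ℝ (covariate w) (πhat n ω)))
    (dph := fun ω n w => deriv Λ (inner ℝ (covariate w) (πhat n ω)))
    (hconv hm.continuousOn) (hconv hm.continuousOn_deriv) (hconv hm.continuousOn_inv_one_sub)
    (hconv hm.continuousOn_inv_mul)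

end FixedGroup


/-! ### Negligibility and covariances of the bootstrap weights -/

/-- If the averages of `a_i²` converge, then `max_{i < n} a_i = o(√n)`. -/
lemma eventually_le_mul_sqrt {a : ℕ → ℝ} (ha : ∀ i, 0 ≤ a i) {L : ℝ}
    (h : Tendsto (fun n : ℕ => (n : ℝ)⁻¹ * ∑ i : Fin n, a i ^ 2) atTop (𝓝 L)) {δ : ℝ}
    (hδ : 0 < δ) : ∀ᶠ n : ℕ in atTop, ∀ i : Fin n, a i ≤ δ * √n := by
  -- With `A_n` the average of the first `n` squares, `a_n² / (n + 1) = A_{n+1} - (n / (n + 1))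
  -- A_n`, and both terms tend to `L`.
  have hterm : Tendsto (fun n : ℕ => ((n + 1 : ℕ) : ℝ)⁻¹ * a n ^ 2) atTop (𝓝 0) := by
    have h1 := h.comp (tendsto_add_atTop_nat 1)
    have h2 := h.mul (tendsto_natCast_div_add_atTop (1 : ℝ))
    rw [mul_one] at h2
    have h3 := h1.sub h2
    rw [sub_self] at h3
    refine h3.congr fun n => ?_
    simp only [Function.comp, Fin.sum_univ_castSucc]
    rcases Nat.eq_zero_or_pos n with rfl | hn
    · simp
    · have : (0 : ℝ) < n := by exact_mod_cast hn
      simp only [Fin.val_castSucc, Fin.val_last]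
      push_cast
      field_simp
      ring
  obtain ⟨N, hN⟩ := eventually_atTop.1 (hterm.eventually (gt_mem_nhds (show 0 < δ ^ 2 by positivity)))
  have hs : Tendsto (fun n : ℕ => δ * √n) atTop atTop :=
    (Real.tendsto_sqrt_atTop.comp tendsto_natCast_atTop_atTop).const_mul_atTop hδ
  -- The finitely many indices below `N` are absorbed because `√n` eventually exceeds the sum of
  -- their values.
  filter_upwards [hs.eventually_ge_atTop (∑ i ∈ Finset.range N, a i)] with n hn i
  rcases lt_or_ge (i : ℕ) N with hi | hi
  · exact (Finset.single_le_sum (fun j _ => ha j) (Finset.mem_range.2 hi)).trans hn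
  · have h1 := hN i hi
    have hpos : (0 : ℝ) < ((i + 1 : ℕ) : ℝ) := by positivity
    rw [inv_mul_lt_iff₀ hpos] at h1
    -- From `i < n` one has `i + 1 ≤ n`, hence `a_i² < δ² (i + 1) ≤ δ² n`.
    have h2 : ((i + 1 : ℕ) : ℝ) ≤ n := by exact_mod_cast i.2
    refine abs_le_of_sq_le_sq' ?_ (by positivity) |>.2
    rw [mul_pow, Real.sq_sqrt (by positivity)]
    nlinarith [sq_nonneg δ]

section Weights

variable {ι : Type*} [Fintype ι] {S : Set (Obs T k)} {w : ℕ → Obs T k}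
  {Φ : ℕ → Obs T k → EuclideanSpace ℝ ι} {Φ₀ : Obs T k → EuclideanSpace ℝ ι}

lemma weightedUnif_inner (hΦ : ∀ i, WeightedUnif S envelope (fun n w => Φ n w i) fun w => Φ₀ w i)
    (t : EuclideanSpace ℝ ι) :
    WeightedUnif S envelope (fun n w => inner ℝ (Φ n w) t) fun w => inner ℝ (Φ₀ w) t := by
  have h := WeightedUnif.sum Finset.univ (fun w _ => zero_le_one.trans (one_le_envelope w))
    fun i _ => (hΦ i).const_mul (tendsto_const_nhds (x := t i))
  simpa [PiLp.inner_apply] using h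

/-- The sum is the sample mean of `⟨Φ_n, t⟩²`. This converges relative to the squared envelope, so
`Φ_n` may be replaced by `Φ₀`, whose empirical second moments converge by hypothesis. -/
lemma tendsto_sum_inner_sq (hw : ∀ i, w i ∈ S)
    (hΦ : ∀ i, WeightedUnif S envelope (fun n w => Φ n w i) fun w => Φ₀ w i) {M : ℝ}
    (hM : Tendsto (fun n : ℕ => sampleMean (fun i : Fin n => w i) fun w => envelope w * envelope w)
      atTop (𝓝 M)) {C : Matrix ι ι ℝ}
    (hC : ∀ i j, Tendsto (fun n : ℕ => sampleMean (fun i : Fin n => w i)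
      fun w => Φ₀ w i * Φ₀ w j) atTop (𝓝 (C i j))) (t : EuclideanSpace ℝ ι) :
    Tendsto (fun n : ℕ => ∑ i : Fin n, (inner ℝ ((√n)⁻¹ • Φ n (w i)) t) ^ 2) atTop
      (𝓝 (t ⬝ᵥ C *ᵥ t)) := by
  have h0 : Tendsto (fun n : ℕ => sampleMean (fun i : Fin n => w i)
      fun w => inner ℝ (Φ₀ w) t * inner ℝ (Φ₀ w) t) atTop (𝓝 (t ⬝ᵥ C *ᵥ t)) := by
    have h : Tendsto (fun n : ℕ => ∑ a, ∑ b, t a * t b * sampleMean (fun i : Fin n => w i)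
        fun w => Φ₀ w a * Φ₀ w b) atTop (𝓝 (∑ a, ∑ b, t a * t b * C a b)) :=
      tendsto_finsetSum _ fun a _ => tendsto_finsetSum _ fun b _ => (hC a b).const_mul _
    have e : t ⬝ᵥ C *ᵥ t = ∑ a, ∑ b, t a * t b * C a b := by
      simp only [dotProduct, Matrix.mulVec, Finset.mul_sum]
      refine Finset.sum_congr rfl fun a _ => Finset.sum_congr rfl fun b _ => ?_
      ring
    rw [e]
    refine h.congr fun n => ?_
    have e2 : ∀ v : Obs T k, inner ℝ (Φ₀ v) t * inner ℝ (Φ₀ v) t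
        = ∑ a, ∑ b, t a * t b * (Φ₀ v a * Φ₀ v b) := by
      intro v
      have : inner ℝ (Φ₀ v) t = ∑ a, t a * Φ₀ v a := by simp [PiLp.inner_apply]
      rw [this, Finset.sum_mul_sum]
      refine Finset.sum_congr rfl fun a _ => Finset.sum_congr rfl fun b _ => ?_
      ring
    simp only [sampleMean, e2]
    rw [Finset.sum_comm (s := Finset.univ (α := Fin n)), Finset.mul_sum]
    refine Finset.sum_congr rfl fun a _ => ?_
    rw [Finset.sum_comm (s := Finset.univ (α := Fin n)), Finset.mul_sum]
    refine Finset.sum_congr rfl fun b _ => ?_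
    rw [← Finset.mul_sum]
    ring
  have hu := weightedUnif_inner hΦ t
  refine ((hu.mul hu).tendsto_sampleMean (s := fun n (i : Fin n) => w i) (fun n i => hw i)
    hM h0).congr fun n => ?_
  rw [sampleMean, Finset.mul_sum]
  refine Finset.sum_congr rfl fun i _ => ?_
  rw [real_inner_smul_left, mul_pow, inv_pow, Real.sq_sqrt (by positivity), sq]

/-- Eventually `|⟨Φ_n, t⟩|` is at most `B + 1` times the envelope: `B` for the limit and 1 for the
approximation error. The largest of the first `n` envelope values is `o(√n)`. -/
lemma eventually_inner_le (hw : ∀ i, w i ∈ S)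
    (hΦ : ∀ i, WeightedUnif S envelope (fun n w => Φ n w i) fun w => Φ₀ w i) {M : ℝ}
    (hM : Tendsto (fun n : ℕ => sampleMean (fun i : Fin n => w i) fun w => envelope w * envelope w)
      atTop (𝓝 M)) (t : EuclideanSpace ℝ ι) {δ : ℝ} (hδ : 0 < δ) :
    ∀ᶠ n : ℕ in atTop, ∀ i : Fin n, |inner ℝ ((√n)⁻¹ • Φ n (w i)) t| ≤ δ := by
  have hu := weightedUnif_inner hΦ t
  obtain ⟨B, hB, hb⟩ := hu.bound
  have hmax := eventually_le_mul_sqrt (a := fun i => envelope (w i))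
    (fun i => zero_le_one.trans (one_le_envelope _)) (L := M)
    (by simpa only [sq, sampleMean] using hM) (δ := δ / (B + 1)) (by positivity)
  filter_upwards [hmax, hu.approx 1 one_pos, eventually_gt_atTop 0] with n h1 h2 hn i
  have hn' : (0 : ℝ) < √n := Real.sqrt_pos.2 (by exact_mod_cast hn)
  have h3 : |inner ℝ (Φ n (w i)) t| ≤ (B + 1) * envelope (w i) := by
    have e : inner ℝ (Φ n (w i)) t = (inner ℝ (Φ n (w i)) t - inner ℝ (Φ₀ (w i)) t)
      + inner ℝ (Φ₀ (w i)) t := by ring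
    rw [e]
    refine (abs_add_le _ _).trans ?_
    linarith [h2 _ (hw i), hb _ (hw i)]
  rw [real_inner_smul_left, abs_mul, abs_of_pos (inv_pos.2 hn'), inv_mul_le_iff₀ hn']
  calc _ ≤ (B + 1) * envelope (w i) := h3
    _ ≤ (B + 1) * (δ / (B + 1) * √n) := by
        refine mul_le_mul_of_nonneg_left (h1 i) (by positivity)
    _ = √n * δ := by field_simp

end Weights

/-! ### Measurability of the bootstrap draw -/

/-- The inverse is `det⁻¹` times the adjugate. It is measurable everywhere, including singular
matrices, where the convention `0⁻¹ = 0` applies; this matters because an estimated information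
matrix may be singular. -/
lemma measurable_matrix_inv_apply {ι : Type*} [Fintype ι] [DecidableEq ι] (a b : ι) :
    Measurable fun M : ι → ι → ℝ => (Matrix.of M)⁻¹ a b := by
  have h1 : Continuous fun M : ι → ι → ℝ => (Matrix.of M).det := continuous_id.matrix_det
  have h2 : Continuous fun M : ι → ι → ℝ => (Matrix.of M).adjugate a b :=
    (Continuous.matrix_adjugate (A := fun M : ι → ι → ℝ => Matrix.of M) continuous_id).matrix_elem a b
  have e : (fun M : ι → ι → ℝ => (Matrix.of M)⁻¹ a b)
      = fun M => ((Matrix.of M).det)⁻¹ * (Matrix.of M).adjugate a b := by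
    ext M
    rw [Matrix.inv_def, Ring.inverse_eq_inv', Matrix.smul_apply, smul_eq_mul]
  rw [e]
  exact h1.measurable.inv.mul h2.measurable

section Measurability

variable {n : ℕ} {p dp : (Fin n → Obs T k) → Obs T k → ℝ} {g t : Period T}

lemma measurable_sampleMean {f : (Fin n → Obs T k) → Obs T k → ℝ}
    (hf : ∀ j, Measurable fun s => f s (s j)) : Measurable fun s => sampleMean s (f s) :=
  (Finset.measurable_fun_sum _ fun j _ => hf j).const_mul _

/-- Plug-in influence functions at the sample points are measurable functions of the sample. -/
lemma measurable_sample_psi (hp : ∀ j, Measurable fun s => p s (s j))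
    (hd : ∀ j, Measurable fun s => dp s (s j)) (j : Fin n) :
    Measurable fun s => psiG (sampleMean s) g t (s j) - psiC (sampleMean s) g t (p s) (dp s) (s j) := by
  have hG : ∀ j, Measurable fun s : Fin n → Obs T k => grp g (s j) := fun j =>
    (measurable_grp g).comp (measurable_pi_apply j)
  have hC : ∀ j, Measurable fun s : Fin n → Obs T k => ctrl (s j) := fun j =>
    measurable_ctrl.comp (measurable_pi_apply j)
  have hD : ∀ j, Measurable fun s : Fin n → Obs T k => longDiff g t (s j) := fun j =>
    (measurable_longDiff g t).comp (measurable_pi_apply j)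
  have hX : ∀ (a : Fin k) j, Measurable fun s : Fin n → Obs T k => covariate (s j) a := fun a j => by
    have := measurable_covariate.comp (measurable_pi_apply (X := fun _ : Fin n => Obs T k) j)
    simp only [Function.comp_def] at this
    fun_prop
  have hwG : ∀ j, Measurable fun s => weightG (sampleMean s) g (s j) := fun j =>
    (hG j).div (measurable_sampleMean hG)
  have hmG := measurable_sampleMean (f := fun s w => weightG (sampleMean s) g w * longDiff g t w)
    fun j => (hwG j).mul (hD j)
  have hO : ∀ j, Measurable fun s => oddsWeight (p s) (s j) := fun j =>
    ((hp j).mul (hC j)).div ((hp j).const_sub 1)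
  have hmO := measurable_sampleMean hO
  have hwC : ∀ j, Measurable fun s => weightC (sampleMean s) (p s) (s j) := fun j =>
    (hO j).div hmO
  have hmC := measurable_sampleMean (f := fun s w => weightC (sampleMean s) (p s) w * longDiff g t w)
    fun j => (hwC j).mul (hD j)
  have hI : ∀ a b : Fin k, Measurable fun s => infoMatrix (sampleMean s) g (p s) (dp s) a b :=
    fun a b => measurable_sampleMean (f := fun s w => (grp g w + ctrl w) * dp s w ^ 2 /
        (p s w * (1 - p s w)) * (covariate w a * covariate w b)) fun j =>
      ((((hG j).add (hC j)).mul ((hd j).pow_const 2)).div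
        ((hp j).mul ((hp j).const_sub 1))).mul ((hX a j).mul (hX b j))
  have hInv : ∀ a b : Fin k, Measurable fun s => (infoMatrix (sampleMean s) g (p s) (dp s))⁻¹ a b :=
    fun a b => (measurable_matrix_inv_apply a b).comp
      (measurable_pi_lambda _ fun a => measurable_pi_lambda _ fun b => hI a b)
  have hξ : ∀ (a : Fin k) j, Measurable fun s =>
      scoreInfluence (sampleMean s) g (p s) (dp s) (s j) a := fun a j => by
    simp only [scoreInfluence, Matrix.mulVec, dotProduct]
    exact Finset.measurable_fun_sum _ fun b _ => (hInv a b).mul ((hX b j).mul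
      (((((hG j).add (hC j)).mul ((hG j).sub (hp j))).mul (hd j)).div
        ((hp j).mul ((hp j).const_sub 1))))
  have hM : ∀ a : Fin k, Measurable fun s => Mvec (sampleMean s) g t (p s) (dp s) a := fun a =>
    (measurable_sampleMean (f := fun s w => covariate w a * (ctrl w / (1 - p s w)) ^ 2 * dp s w *
        (longDiff g t w - sampleMean s fun v => weightC (sampleMean s) (p s) v * longDiff g t v))
      fun j => (((hX a j).mul (((hC j).div
      ((hp j).const_sub 1)).pow_const 2)).mul (hd j)).mul ((hD j).sub hmC)).div hmO
  refine ((hwG j).mul ((hD j).sub hmG)).sub (((hwC j).mul ((hD j).sub hmC)).add ?_)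
  simp only [dotProduct]
  exact Finset.measurable_fun_sum _ fun a _ => (hM a).mul (hξ a j)

/-- Plug-in influence functions at the sample points only depend on the nuisance functions at the
sample points. -/
lemma sample_psi_congr {s : Fin n → Obs T k} {p p' dp : Obs T k → ℝ} (h : ∀ j, p (s j) = p' (s j))
    (j : Fin n) :
    psiG (sampleMean s) g t (s j) - psiC (sampleMean s) g t p dp (s j)
      = psiG (sampleMean s) g t (s j) - psiC (sampleMean s) g t p' dp (s j) := by
  have hO : ∀ j, oddsWeight p (s j) = oddsWeight p' (s j) := fun j => by simp only [oddsWeight, h]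
  have hmO : sampleMean s (oddsWeight p) = sampleMean s (oddsWeight p') := by
    simp only [sampleMean, hO]
  have hM : Mvec (sampleMean s) g t p dp = Mvec (sampleMean s) g t p' dp := by
    funext a
    simp only [Mvec, weightC, hmO]
    simp only [sampleMean, hO, h]
  simp only [psiC, weightC, scoreInfluence, infoMatrix, hmO, hM]
  simp only [sampleMean, hO, h]

end Measurability


/-! ### The population influence functions -/

section Population

variable {μ : Measure (Obs T k)} {Λ : Period T → ℝ → ℝ}
  {Par : Period T → Set (EuclideanSpace ℝ (Fin k))} {π₀ : Period T → EuclideanSpace ℝ (Fin k)}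

/-- The influence functions evaluated at the parametric propensity score. -/
noncomputable def psiParam (μ : Measure (Obs T k)) (Λ : Period T → ℝ → ℝ)
    (π₀ : Period T → EuclideanSpace ℝ (Fin k)) : Obs T k → EuclideanSpace ℝ (GroupTime T) :=
  PsiVec (fun f => ∫ w, f w ∂μ) (fitted Λ π₀)
    (fun g w => deriv (Λ g) (inner ℝ (covariate w) (π₀ g)))

variable [IsProbabilityMeasure μ]

/-- The model identity holds almost surely given `G_g + C = 1`, which is all that the influence
functions see; there are finitely many coordinates. -/
lemma psi_ae_eq_psiParam (hover : Overlap μ)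
    (hps : ∀ g : Period T, 2 ≤ g.1 → PropensityModel μ g (Λ g) (Par g) (π₀ g)) :
    Psi μ Λ π₀ =ᵐ[μ] psiParam μ Λ π₀ := by
  have h : ∀ i : GroupTime T, (fun w => Psi μ Λ π₀ w i) =ᵐ[μ] fun w => psiParam μ Λ π₀ w i := by
    intro i
    have hg := (hover i.1.1 i.2.1).1
    exact psi_congr ((ae_cond_iff (measurableSet_groupOrControl i.1.1)
      (measure_ne_top μ _)).1 (hps _ i.2.1).model) i.1.2 _
  filter_upwards [ae_all_iff.2 h] with w hw
  ext i
  exact hw i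

lemma memLp_psi (hover : Overlap μ)
    (hps : ∀ g : Period T, 2 ≤ g.1 → PropensityModel μ g (Λ g) (Par g) (π₀ g))
    (h : ∀ i : GroupTime T, MemLp (fun w => psiParam μ Λ π₀ w i) 2 μ) :
    MemLp (Psi μ Λ π₀) 2 μ :=
  (memLp_congr_ae (psi_ae_eq_psiParam hover hps)).2 (MemLp.of_eval_piLp h)

omit [IsProbabilityMeasure μ] in
lemma integrable_psi_mul (h : MemLp (Psi μ Λ π₀) 2 μ) (i j : GroupTime T) :
    Integrable (fun w => Psi μ Λ π₀ w i * Psi μ Λ π₀ w j) μ :=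
  (h.eval_piLp i).integrable_mul (h.eval_piLp j)

omit [IsProbabilityMeasure μ] in
-- `x'Σx = E[(x'Ψ)²]`.
lemma posSemidef_asymptoticCov (h : MemLp (Psi μ Λ π₀) 2 μ) :
    (asymptoticCov μ Λ π₀).PosSemidef := by
  refine .of_dotProduct_mulVec_nonneg ?_ fun x => ?_
  · ext i j
    simp only [asymptoticCov, Matrix.conjTranspose_apply, Matrix.of_apply, star_trivial]
    exact integral_congr_ae (Eventually.of_forall fun w => mul_comm _ _)
  · rw [star_trivial, asymptoticCov, dotProduct_mulVec_integral (integrable_psi_mul h)]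
    refine integral_nonneg fun w => ?_
    have e : ∑ a, ∑ b, x a * x b * (Psi μ Λ π₀ w a * Psi μ Λ π₀ w b)
        = (∑ a, x a * Psi μ Λ π₀ w a) ^ 2 := by
      rw [sq, Finset.sum_mul_sum]
      refine Finset.sum_congr rfl fun a _ => Finset.sum_congr rfl fun b _ => ?_
      ring
    rw [Pi.zero_apply, e]
    exact sq_nonneg _

lemma asymptoticCov_eq (hover : Overlap μ)
    (hps : ∀ g : Period T, 2 ≤ g.1 → PropensityModel μ g (Λ g) (Par g) (π₀ g))
    (i j : GroupTime T) :
    asymptoticCov μ Λ π₀ i j = ∫ w, psiParam μ Λ π₀ w i * psiParam μ Λ π₀ w j ∂μ := by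
  refine integral_congr_ae ?_
  filter_upwards [psi_ae_eq_psiParam hover hps] with w hw
  rw [hw]

end Population

/-! ### The bootstrap draw as a measurable function of sample and multipliers -/

/-- The rescaled and recentred bootstrap draw is a weighted sum of the multipliers. -/
lemma sqrt_smul_attStar_sub {n : ℕ} (s : Fin n → Obs T k) (v : Fin n → ℝ) (Λ : Period T → ℝ → ℝ)
    (π : Period T → EuclideanSpace ℝ (Fin k)) :
    √n • (attStar s v Λ π - attHat s Λ π) = ∑ i, v i • ((√n)⁻¹ • PsiHat s Λ π (s i)) := by
  rw [attStar, add_sub_cancel_left, smul_smul]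
  -- Also valid at `n = 0`, where both sides are 0.
  have e : √(n : ℝ) * (n : ℝ)⁻¹ = (√n)⁻¹ := by
    rw [← div_eq_mul_inv, Real.sqrt_div_self', one_div]
  rw [e, Finset.smul_sum]
  exact Finset.sum_congr rfl fun i _ => smul_comm _ _ _

/-- A version of the bootstrap draw that only uses the values of the `Λ g` on the sets `K g`. -/
noncomputable def truncatedDraw (Λ : Period T → ℝ → ℝ) (K : Period T → Set ℝ) {n : ℕ}
    (πhat : (Fin n → Obs T k) → Period T → EuclideanSpace ℝ (Fin k))
    (z : (Fin n → Obs T k) × (Fin n → ℝ)) : EuclideanSpace ℝ (GroupTime T) :=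
  ∑ i, z.2 i • ((√n)⁻¹ • PsiVec (sampleMean z.1)
    (fitted (fun g => (K g).indicator (Λ g)) (πhat z.1))
    (fun g w => deriv (Λ g) (inner ℝ (covariate w) (πhat z.1 g))) (z.1 i))

/-- Only `Λ` needs truncation: the derivative of an arbitrary real function is measurable. The
condition `2 ≤ g` is enough because `GroupTime` contains no other groups. -/
lemma measurable_truncatedDraw {Λ : Period T → ℝ → ℝ} {K : Period T → Set ℝ} {n : ℕ}
    {πhat : (Fin n → Obs T k) → Period T → EuclideanSpace ℝ (Fin k)}
    (hπm : ∀ g, Measurable fun s => πhat s g)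
    (hΛ : ∀ g : Period T, 2 ≤ g.1 → Measurable ((K g).indicator (Λ g))) :
    Measurable (truncatedDraw Λ K πhat) := by
  refine Finset.measurable_fun_sum _ fun i _ => ?_
  have h : Measurable fun s : Fin n → Obs T k => PsiVec (sampleMean s)
      (fitted (fun g => (K g).indicator (Λ g)) (πhat s))
      (fun g w => deriv (Λ g) (inner ℝ (covariate w) (πhat s g))) (s i) := by
    refine (WithLp.measurable_toLp 2 (GroupTime T → ℝ)).comp (measurable_pi_lambda _ fun a => ?_)
    have hin : ∀ j, Measurable fun s : Fin n → Obs T k =>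
        (inner ℝ (covariate (s j)) (πhat s a.1.1) : ℝ) := fun j =>
      (measurable_covariate.comp (measurable_pi_apply j)).inner (hπm _)
    have hp : ∀ j, Measurable fun s : Fin n → Obs T k =>
        (K a.1.1).indicator (Λ a.1.1) (inner ℝ (covariate (s j)) (πhat s a.1.1)) := fun j =>
      (hΛ _ a.2.1).comp (hin j)
    have hd : ∀ j, Measurable fun s : Fin n → Obs T k =>
        deriv (Λ a.1.1) (inner ℝ (covariate (s j)) (πhat s a.1.1)) := fun j =>
      (measurable_deriv (Λ a.1.1)).comp (hin j)
    exact measurable_sample_psi (g := a.1.1) (t := a.1.2)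
      (p := fun s w => (K a.1.1).indicator (Λ a.1.1) (inner ℝ (covariate w) (πhat s a.1.1)))
      (dp := fun s w => deriv (Λ a.1.1) (inner ℝ (covariate w) (πhat s a.1.1))) hp hd i
  have h2 : Measurable fun z : (Fin n → Obs T k) × (Fin n → ℝ) =>
      PsiVec (sampleMean z.1) (fitted (fun g => (K g).indicator (Λ g)) (πhat z.1))
        (fun g w => deriv (Λ g) (inner ℝ (covariate w) (πhat z.1 g))) (z.1 i) :=
    h.comp measurable_fst
  fun_prop

lemma PsiHat_eq_truncated {Λ : Period T → ℝ → ℝ} {K : Period T → Set ℝ} {n : ℕ}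
    {s : Fin n → Obs T k} {π : Period T → EuclideanSpace ℝ (Fin k)}
    (h : ∀ g : Period T, 2 ≤ g.1 → ∀ j, inner ℝ (covariate (s j)) (π g) ∈ K g) (i : Fin n) :
    PsiHat s Λ π (s i) = PsiVec (sampleMean s) (fitted (fun g => (K g).indicator (Λ g)) π)
      (fun g w => deriv (Λ g) (inner ℝ (covariate w) (π g))) (s i) := by
  ext a
  refine sample_psi_congr (fun j => ?_) i
  simp only [fitted]
  rw [Set.indicator_of_mem (h _ a.2.1 j)]

lemma PropensityModel.measurable_indicator {μ : Measure (Obs T k)} {g : Period T} {Λ : ℝ → ℝ}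
    {Par : Set (EuclideanSpace ℝ (Fin k))} {π₀ : EuclideanSpace ℝ (Fin k)}
    (hm : PropensityModel μ g Λ Par π₀) : Measurable ((indexSet μ Par).indicator Λ) := by
  classical
  have h := hm.continuousOn.measurable_piecewise (continuousOn_const (c := (0 : ℝ))
    (s := (indexSet μ Par)ᶜ)) hm.isCompact_indexSet.isClosed.measurableSet
  convert! h using 1

/-- Continuous images of conditional laws. -/
lemma TendstoCondLawInProbability.map {Ω E F : Type*} [MeasurableSpace Ω] [TopologicalSpace E]
    [MeasurableSpace E] [BorelSpace E] [TopologicalSpace F] [MeasurableSpace F] [BorelSpace F]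
    {P : Measure Ω} {𝓖 : ℕ → MeasurableSpace Ω} {Z : ℕ → Ω → E} {ν : Measure E}
    (h : TendstoCondLawInProbability P 𝓖 Z ν) {Γ : E → F} (hΓ : Continuous Γ) :
    TendstoCondLawInProbability P 𝓖 (fun n ω => Γ (Z n ω)) (ν.map Γ) where
  le := h.le
  aemeasurable n := hΓ.measurable.comp_aemeasurable (h.aemeasurable n)
  tendsto f := by
    have := h.tendsto (f.compContinuous ⟨Γ, hΓ⟩)
    rw [integral_map hΓ.measurable.aemeasurable
      f.continuous.measurable.stronglyMeasurable.aestronglyMeasurable]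
    exact this

end DID

/-! ### The conditional limit law of the bootstrap draw. -/

theorem theorem3 {T k : ℕ}
    -- population law of a unit with its potential outcomes; law of the observed data
    (Q : Measure (DID.PotentialUnit T k)) [IsProbabilityMeasure Q]
    (μ : Measure (DID.Obs T k)) (hμ : μ = Q.map DID.observe)
    -- the assumptions on the population
    (Λ : DID.Period T → ℝ → ℝ) (Par : DID.Period T → Set (EuclideanSpace ℝ (Fin k)))
    (π₀ : DID.Period T → EuclideanSpace ℝ (Fin k))
    (hpar : DID.ParallelTrends Q) (hirr : DID.Irreversible μ) (hover : DID.Overlap μ)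
    (hps : ∀ g : DID.Period T, 2 ≤ g.1 → DID.PropensityModel μ g (Λ g) (Par g) (π₀ g))
    (hY : DID.SquareIntegrableOutcomes μ)
    -- the sample, iid from the law of the observed data
    {Ω : Type*} [MeasurableSpace Ω] (P : Measure Ω) [IsProbabilityMeasure P]
    (W : ℕ → Ω → DID.Obs T k) (hWm : ∀ i, Measurable (W i))
    (hWind : iIndepFun W P) (hWlaw : ∀ i, P.map (W i) = μ)
    -- the maximum likelihood estimators, measurable functions of the sample
    (πhat : (n : ℕ) → (Fin n → DID.Obs T k) → DID.Period T → EuclideanSpace ℝ (Fin k))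
    (hπm : ∀ n g, Measurable fun s => πhat n s g)
    (hπ : ∀ n, ∀ g : DID.Period T, 2 ≤ g.1 → ∀ᵐ ω ∂P,
      DID.IsMLE (DID.firstN W n ω) g (Λ g) (Par g) (πhat n (DID.firstN W n ω) g))
    -- the multipliers
    (V : ℕ → Ω → ℝ) (hVm : ∀ i, Measurable (V i))
    (hVind : iIndepFun V P) (hVid : ∀ i, IdentDistrib (V i) (V 0) P P)
    (hVbdd : ∃ B : ℝ, ∀ᵐ ω ∂P, |V 0 ω| ≤ B)
    (hVmean : ∫ ω, V 0 ω ∂P = 0) (hVvar : variance (V 0) P = 1)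
    (hVW : IndepFun (fun ω i => W i ω) (fun ω i => V i ω) P)
    -- the recentred and rescaled bootstrap draw
    (Z : ℕ → Ω → EuclideanSpace ℝ (DID.GroupTime T))
    (hZ : ∀ n ω, Z n ω = Real.sqrt n •
      (DID.attStar (DID.firstN W n ω) (DID.firstN V n ω) Λ (πhat n (DID.firstN W n ω))
        - DID.attHat (DID.firstN W n ω) Λ (πhat n (DID.firstN W n ω))))
    {F : Type*} [TopologicalSpace F] [MeasurableSpace F] [BorelSpace F] :
    MemLp (DID.Psi μ Λ π₀) 2 μ ∧
    DID.TendstoCondLawInProbability P (DID.sampleSigma W) Z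
      (multivariateGaussian 0 (DID.asymptoticCov μ Λ π₀)) ∧
    ∀ Γ : EuclideanSpace ℝ (DID.GroupTime T) → F, Continuous Γ →
      DID.TendstoCondLawInProbability P (DID.sampleSigma W) (fun n ω => Γ (Z n ω))
        ((multivariateGaussian 0 (DID.asymptoticCov μ Λ π₀)).map Γ) := by
  have hμP : IsProbabilityMeasure μ := by
    rw [hμ]
    exact Measure.isProbabilityMeasure_map DID.measurable_observe.aemeasurable
  have hW : ∀ n, Measurable (DID.firstN W n) := fun n => measurable_pi_lambda _ fun i => hWm i
  have hV : ∀ n, Measurable (DID.firstN V n) := fun n => measurable_pi_lambda _ fun i => hVm i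
  have hunif : ∀ᵐ ω ∂P, ∀ i : DID.GroupTime T,
      DID.WeightedUnif {w | DID.covariate w ∈ DID.suppX μ} DID.envelope
        (fun n w => DID.PsiHat (DID.firstN W n ω) Λ (πhat n (DID.firstN W n ω)) w i)
        (fun w => DID.psiParam μ Λ π₀ w i) :=
    ae_all_iff.2 fun i => (hps _ i.2.1).ae_weightedUnif_psi (hover _ i.2.1).1 hY i.1.2 hWm hWind
      hWlaw (πhat := fun n ω => πhat n (DID.firstN W n ω) i.1.1) fun n => hπ n _ i.2.1
  have hLp := DID.memLp_envelope (T := T) (k := k) hY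
  have hpsi : ∀ i : DID.GroupTime T, MemLp (fun w => DID.psiParam μ Λ π₀ w i) 2 μ := by
    -- Any single good path will do: uniform convergence also records the bound of the limit by the
    -- envelope, a statement that does not involve the path.
    obtain ⟨ω, hω⟩ := hunif.exists
    intro i
    have hm := hps _ i.2.1
    exact (hω i).memLp (DID.aemeasurable_psi (hm.aemeasurable_comp hm.continuousOn)
      (hm.aemeasurable_comp hm.continuousOn_deriv) i.1.2) hLp
  have hmem := DID.memLp_psi hover hps hpsi
  have hS := DID.posSemidef_asymptoticCov hmem
  have hcov : ∀ᵐ ω ∂P, ∀ i, DID.covariate (W i ω) ∈ DID.suppX μ := by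
    rw [ae_all_iff]
    intro i
    exact ae_of_ae_map (hWm i).aemeasurable (by rw [hWlaw i]; exact DID.covariate_mem_suppX)
  -- Sample covariates lie in the support and estimates in the parameter sets, so almost surely the
  -- truncation is never active.
  have hindex : ∀ᵐ ω ∂P, ∀ n, ∀ g : DID.Period T, 2 ≤ g.1 → ∀ j : Fin n,
      inner ℝ (DID.covariate (DID.firstN W n ω j)) (πhat n (DID.firstN W n ω) g)
        ∈ DID.indexSet μ (Par g) := by
    have hmle : ∀ᵐ ω ∂P, ∀ n, ∀ g : DID.Period T, 2 ≤ g.1 →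
        DID.IsMLE (DID.firstN W n ω) g (Λ g) (Par g) (πhat n (DID.firstN W n ω) g) := by
      simp only [ae_all_iff]
      exact hπ
    filter_upwards [hcov, hmle] with ω h1 h2 n g hg j
    exact DID.inner_mem_indexSet (h1 j) (h2 n g hg).1
  have hdraw : ∀ n, Measurable
      (DID.truncatedDraw Λ (fun g => DID.indexSet μ (Par g)) (πhat n)) := fun n =>
    DID.measurable_truncatedDraw (hπm n) fun g hg => (hps g hg).measurable_indicator
  have htrunc : ∀ᵐ ω ∂P, ∀ n (v : Fin n → ℝ),
      DID.truncatedDraw Λ (fun g => DID.indexSet μ (Par g)) (πhat n) (DID.firstN W n ω, v)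
        = ∑ i, v i • ((√n)⁻¹ • DID.PsiHat (DID.firstN W n ω) Λ (πhat n (DID.firstN W n ω))
            (W i ω)) := by
    filter_upwards [hindex] with ω hω n v
    refine Finset.sum_congr rfl fun i _ => ?_
    have h := DID.PsiHat_eq_truncated (Λ := Λ) (hω n) i
    change _ = v i • ((√n)⁻¹ • DID.PsiHat (DID.firstN W n ω) Λ (πhat n (DID.firstN W n ω))
      (DID.firstN W n ω i))
    rw [h]
  have hZae : ∀ n, Z n =ᵐ[P] fun ω =>
      DID.truncatedDraw Λ (fun g => DID.indexSet μ (Par g)) (πhat n)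
        (DID.firstN W n ω, DID.firstN V n ω) := by
    intro n
    filter_upwards [htrunc] with ω hω
    rw [hω, hZ, DID.sqrt_smul_attStar_sub]
    rfl
  have hV2 : P[V 0 ^ 2] = 1 := by
    rw [← hVvar, variance_of_integral_eq_zero (hVm 0).aemeasurable hVmean]
    rfl
  have hlaw : DID.TendstoCondLawInProbability P (DID.sampleSigma W) Z
      (multivariateGaussian 0 (DID.asymptoticCov μ Λ π₀)) := by
    refine ⟨fun n => (hW n).comap_le, fun n =>
      ⟨_, (hdraw n).comp ((hW n).prodMk (hV n)), hZae n⟩, fun f => ?_⟩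
    -- The stronger almost sure convergence of the conditional expectations is what gets proved.
    refine tendstoInMeasure_of_tendsto_ae (fun n =>
      (stronglyMeasurable_condExp.mono (hW n).comap_le).aestronglyMeasurable) ?_
    have hcond : ∀ n, P[fun ω => f (Z n ω) | DID.sampleSigma W n] =ᵐ[P] fun ω =>
        ∫ ω', f (DID.truncatedDraw Λ (fun g => DID.indexSet μ (Par g)) (πhat n)
          (DID.firstN W n ω, DID.firstN V n ω')) ∂P := by
      intro n
      have hind : IndepFun (DID.firstN W n) (DID.firstN V n) P :=
        hVW.comp (φ := fun (w : ℕ → DID.Obs T k) (i : Fin n) => w i)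
          (ψ := fun (v : ℕ → ℝ) (i : Fin n) => v i) (by fun_prop) (by fun_prop)
      have h1 : P[fun ω => f (Z n ω) | DID.sampleSigma W n] =ᵐ[P]
          P[fun ω => f (DID.truncatedDraw Λ (fun g => DID.indexSet μ (Par g)) (πhat n)
            (DID.firstN W n ω, DID.firstN V n ω)) | DID.sampleSigma W n] := by
        refine condExp_congr_ae ?_
        filter_upwards [hZae n] with ω hω
        rw [hω]
      exact h1.trans (DID.condExp_eq_integral_of_indepFun (hW n) (hV n) hind
        (f.continuous.measurable.comp (hdraw n)) (c := ‖f‖) fun z => f.norm_coe_le_norm _)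
    have llnH := DID.tendsto_sampleMean (f := fun w => DID.envelope w * DID.envelope w)
      hWm hWind hWlaw (hLp.integrable_mul hLp)
    have llnC : ∀ᵐ ω ∂P, ∀ i j : DID.GroupTime T, Tendsto (fun n =>
        DID.sampleMean (DID.firstN W n ω) fun w =>
          DID.psiParam μ Λ π₀ w i * DID.psiParam μ Λ π₀ w j) atTop
        (𝓝 (DID.asymptoticCov μ Λ π₀ i j)) := by
      simp only [ae_all_iff, DID.asymptoticCov_eq hover hps]
      exact fun i j => DID.tendsto_sampleMean hWm hWind hWlaw
        ((hpsi i).integrable_mul (hpsi j))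
    filter_upwards [ae_all_iff.2 hcond, htrunc, hunif, hcov, llnH, llnC]
      with ω hcond htrunc hunif hcov hH hC
    -- From here `ω` is fixed: the weights are deterministic, and the only randomness left is that
    -- of the multipliers under the integral.
    simp only [hcond, htrunc]
    let Φ : ℕ → DID.Obs T k → EuclideanSpace ℝ (DID.GroupTime T) := fun n =>
      DID.PsiHat (DID.firstN W n ω) Λ (πhat n (DID.firstN W n ω))
    have hsum := DID.tendsto_sum_inner_sq (w := fun i => W i ω) (Φ := Φ)
      (Φ₀ := DID.psiParam μ Λ π₀) hcov hunif hH hC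
    have hmax := fun (t : EuclideanSpace ℝ (DID.GroupTime T)) (δ : ℝ) (hδ : δ > 0) =>
      DID.eventually_inner_le (w := fun i => W i ω) (Φ := Φ)
        (Φ₀ := DID.psiParam μ Λ π₀) hcov hunif hH t hδ
    exact DID.tendsto_integral_multiplier_sum hVm hVind hVid hVmean hV2
      (fun n i => (√n)⁻¹ • Φ n (W i ω)) hS hsum hmax f
  exact ⟨hmem, hlaw, fun Γ hΓ => hlaw.map hΓ⟩
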